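/- Let $d\in\mathbb{N}$, $a\in[0,1]$, $\sigma>0$, and let $\phi_a(z)=z$ for $z>0$, $\phi_a(z)=az$ for $z\le 0$, applied component-wise to vectors of $\mathbb{R}^d$; $\|\cdot\|$ is the Euclidean norm. Let $W^{(1)},W^{(2)},\dots$ be random $d\times d$ matrices all of whose entries are independent $\mathcal{N}(0,\sigma^2)$ variables, let all biases $b^{(k)}$ be zero, let $0\ne x^{(0)}\in\mathbb{R}^d$ be deterministic, and let $x^{(k+1)}=\phi_a(W^{(k+1)}x^{(k)}+b^{(k+1)})$ be the layer outputs. Let $z\sim\mathcal{N}(0,I_d)$. For $a\in(0,1]$ let $\mu_a(\sigma):=\mathbb{E}\log\|\phi_a(\sigma z)\|$, and for $s>0$ let $\bar\sigma_a(s,d):=I_a(s,d)^{-1/s}$, where for $0<s<2$ $$I_a(s,d)=\frac{2^{s/2}}{\Gamma(1-s/2)}\sum_{n=0}^d\binom dn\frac1{2^d}\sum_{k=0}^\infty w_{k,n}\,\mathrm{B}\!\left(k+1-\tfrac s2,\tfrac d2+\tfrac s2\right),$$ $$w_{k,n}=\tfrac12(1-a^2)^k\left[\binom{\frac{d-n}2+k-1}{k}n+a^2(d-n)\binom{\frac{d-n}2+k}{k}\right],$$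 with the convention $0^0=1$ and with $\binom rk=\frac{r(r-1)\cdots(r-k+1)}{k!}$ for real $r$, while $I_a(2,d)=(1+a^2)\frac d2$, and $I_a(s,d)=\mathbb{E}\|\phi_a(z)\|^s$ for $s>2$. Then: 1. If $a=0$ (ReLU), then $x^{(k)}\to0$ almost surely as $k\to\infty$, for every $\sigma>0$. 2. If $a\in(0,1]$, then: - $\mu_a(\sigma)$ is the top Lyapunov exponent: $\frac1k\log\|x^{(k)}\|\to\mu_a(\sigma)$ almost surely. - $\mu_a(\sigma)<0$ if and only if $\sigma=\bar\sigma_a(s,d)$ for some $s>0$. - If $\sigma=\bar\sigma_a(s,d)$ with $s>0$, then $x^{(k)}\to0$ almost surely when $s\ge1$; moreover, for every $s>0$, all $x^{(k)}$ lie in $L_p$ and $x^{(k)}\to0$ in $L_p$ for every $p\in(0,s)$, and there are deterministic indices $n_1<n_2<\cdots$ with $x^{(n_k)}\to0$ almost surely. - If $\mu_a(\sigma)>0$, then for every $p>0$ all $x^{(k)}$ lie in $L_p$ and $\left(\mathbb{E}\|x^{(k)}\|^p\right)^{1/p}\to\infty$; and there are deterministic indices $n_1<n_2<\cdots$ with $\|x^{(n_k)}\|\to\infty$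 almost surely. -/

import Mathlib

open MeasureTheory ProbabilityTheory Filter Topology

noncomputable section

namespace ReLUNet

/-- The parametric ReLU activation `φ_a` on scalars: `z` if `z > 0`, and `a z` if `z ≤ 0`.
`a = 0` is ReLU and `a = 1` is the identity (linear activation). -/
def act (a z : ℝ) : ℝ := if 0 < z then z else a * z

/-- `φ_a` applied component-wise to a vector of `ℝᵈ` (with its Euclidean norm). -/
def actVec {d : ℕ} (a : ℝ) (x : EuclideanSpace ℝ (Fin d)) : EuclideanSpace ℝ (Fin d) :=
  WithLp.toLp 2 fun i => act a (x i)

/-- One layer: `x ↦ φ_a (W x + b)`. -/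
def layer {d : ℕ} (a : ℝ) (W : Matrix (Fin d) (Fin d) ℝ) (b x : EuclideanSpace ℝ (Fin d)) :
    EuclideanSpace ℝ (Fin d) :=
  actVec a (WithLp.toLp 2 fun i => ∑ j, W i j * x j + b i)

/-- The output of the `k`-th layer of the network with input `x0`. Here `W k ω` and `b k` are the
weight matrix and the bias of the `(k+1)`-st layer. -/
def output {Ω : Type*} {d : ℕ} (a : ℝ) (W : ℕ → Ω → Matrix (Fin d) (Fin d) ℝ)
    (b : ℕ → EuclideanSpace ℝ (Fin d)) (x0 : EuclideanSpace ℝ (Fin d)) :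
    ℕ → Ω → EuclideanSpace ℝ (Fin d)
  | 0, _ => x0
  | k + 1, ω => layer a (W k ω) (b k) (output a W b x0 k ω)

/-- Gaussian initialization with standard deviation `σ > 0`: all entries of all the weight matrices
are independent centered Gaussians of variance `σ²`, and all biases are zero. -/
structure IsGaussianInit {Ω : Type*} [MeasurableSpace Ω] (P : Measure Ω) {d : ℕ} (σ : ℝ)
    (W : ℕ → Ω → Matrix (Fin d) (Fin d) ℝ) (b : ℕ → EuclideanSpace ℝ (Fin d)) : Prop where
  sigma_pos : 0 < σ
  gaussian : ∀ k i j, HasLaw (fun ω => W k ω i j) (gaussianReal 0 (Real.toNNReal (σ ^ 2))) P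
  indep : iIndepFun (fun (q : ℕ × Fin d × Fin d) (ω : Ω) => W q.1 ω q.2.1 q.2.2) P
  bias_zero : ∀ k, b k = 0

/-- The weights
`w_{k,n} = (1/2) (1 - a²)ᵏ [ C((d-n)/2 + k - 1, k) n + a² (d-n) C((d-n)/2 + k, k) ]`,
with generalized binomial coefficients `C(r, k) = r (r-1) ⋯ (r-k+1) / k!`. -/
def weight (a : ℝ) (d k n : ℕ) : ℝ :=
  1 / 2 * (1 - a ^ 2) ^ k *
    (Ring.choose (((d : ℝ) - n) / 2 + k - 1) k * n
      + a ^ 2 * ((d : ℝ) - n) * Ring.choose (((d : ℝ) - n) / 2 + k) k)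

/-- The explicit series for the `s`-th moment `𝔼 ‖φ_a(z)‖ˢ`, `z ∼ 𝒩(0, I_d)`, for `0 < s < 2`. -/
def momentSeries (a s : ℝ) (d : ℕ) : ℝ :=
  (2 : ℝ) ^ (s / 2) * (1 / Real.Gamma (1 - s / 2)) *
    ∑ n ∈ Finset.range (d + 1), (d.choose n : ℝ) * (1 / 2 ^ d) *
      ∑' k : ℕ, weight a d k n * beta ((k : ℝ) + 1 - s / 2) ((d : ℝ) / 2 + s / 2)

/-- The constant `I_a(s,d)` for `a ∈ (0,1]` and `s > 0`: the explicit series for `s < 2`, the value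
`(1 + a²) d / 2` for `s = 2`, and, for `s > 2` where the series has no meaning, the moment
`𝔼 ‖φ_a(z)‖ˢ` of a standard Gaussian vector `z`. -/
def momentConst (a s : ℝ) (d : ℕ) : ℝ :=
  if s < 2 then momentSeries a s d
  else if s = 2 then (1 + a ^ 2) * ((d : ℝ) / 2)
  else ∫ z, ‖actVec a z‖ ^ s ∂(stdGaussian (EuclideanSpace ℝ (Fin d)))

/-- The critical standard deviation `σ̄_a(s,d) = I_a(s,d)^{-1/s}`. -/
def critSigma (a s : ℝ) (d : ℕ) : ℝ := 1 / momentConst a s d ^ (1 / s)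

/-- The top Lyapunov exponent `μ_a(σ) = 𝔼 log ‖φ_a(σ z)‖`, `z ∼ 𝒩(0, I_d)`. -/
def lyapunov (a σ : ℝ) (d : ℕ) : ℝ :=
  ∫ z, Real.log ‖actVec a (σ • z)‖ ∂(stdGaussian (EuclideanSpace ℝ (Fin d)))

end ReLUNet

end

/-! ### Gamma and beta integrals, binomial series. -/

namespace ReLUNet

/-! The activation is positively homogeneous, so `‖x⁽ᵏ⁺¹⁾‖ = ‖x⁽ᵏ⁾‖ * R_k`, where `R_k` is the norm
of the layer applied to a unit vector (`norm_orbit_succ`). A Gaussian matrix sends every unit vector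
to the same Gaussian law (`map_mulEntries_pi_gaussianReal`), so `R_k` is independent of the past and
distributed as `R = ‖φ_a(σ z)‖` (`indepFun_factor_and_map_factor`).

For `a > 0` put `L = log R` and `m(p) = 𝔼 exp (p L) = 𝔼 Rᵖ`. Then `log ‖x⁽ᵏ⁾‖` is `log ‖x⁽⁰⁾‖` plus
a sum of copies of `L`, and the strong law gives the rate `μ = 𝔼 L`. Moments multiply: `𝔼 ‖x⁽ᵏ⁾‖ᵖ =
‖x⁽⁰⁾‖ᵖ m(p)ᵏ`. Everything else is convexity of `m` with `m(0) = 1` and `m'(0) = μ`. If `m(s) = 1`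
for some `s > 0`, then `μ < 0` and `m < 1` on `(0, s)` (`integral_neg_of_mgf_eq_one`,
`mgf_lt_one_of_lt`). If `μ < 0`, then `m` drops below `1` and must come back, because `L ≥ 1` has
positive probability (`exists_mgf_eq_one`). If `μ > 0`, then `m(p) ≥ 1 + p μ > 1`.

The critical `σ` are exactly the solutions of `m(s) = 1`, since `m(s) = σˢ 𝔼 ‖φ_a(z)‖ˢ` and
`momentConst` is that moment (`momentConst_eq_integral`). For `s < 2` this rests on writing `xˢ` as
an integral over `t` of `t^(-s/2) x² exp (-t x²/2)`, which factorizes over coordinates.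

For `a = 0` each `R_k` vanishes with a fixed positive probability, so almost surely some output is
zero and all later ones are too. -/

lemma lintegral_rpow_mul_exp_neg_mul_Ioi {c y : ℝ} (hc : 0 < c) (hy : 0 < y) :
    ∫⁻ t in Set.Ioi (0 : ℝ), ENNReal.ofReal (t ^ (c - 1) * Real.exp (-(y * t)))
      = ENNReal.ofReal (y ^ (-c) * Real.Gamma c) := by
  have h := Real.integral_rpow_mul_exp_neg_mul_Ioi hc hy
  have hpos : 0 < (1 / y) ^ c * Real.Gamma c := by
    have := Real.Gamma_pos_of_pos hc
    positivity
  have hint : IntegrableOn (fun t : ℝ => t ^ (c - 1) * Real.exp (-(y * t))) (Set.Ioi 0) := by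
    -- A non-integrable function has Bochner integral `0`, but the value in `h` is positive.
    by_contra hcon
    rw [integral_undef hcon] at h
    exact hpos.ne h
  rw [← ofReal_integral_eq_lintegral_ofReal hint, h, one_div, Real.inv_rpow hy.le,
    Real.rpow_neg hy.le]
  filter_upwards [ae_restrict_mem measurableSet_Ioi] with t ht
  have ht : 0 < t := ht
  positivity

/-- The beta integral of the second kind. -/
lemma lintegral_rpow_mul_one_add_rpow_Ioi {α β : ℝ} (hα : 0 < α) (hβ : 0 < β) :
    ∫⁻ t in Set.Ioi (0 : ℝ), ENNReal.ofReal (t ^ (α - 1) * (1 + t) ^ (-(α + β)))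
      = ENNReal.ofReal (beta α β) := by
  have hΓ := Real.Gamma_pos_of_pos (add_pos hα hβ)
  have hΓα := Real.Gamma_pos_of_pos hα
  -- The Gamma integral replaces `Γ(α+β) (1+t)^(-(α+β))` by an integral over `y`; after Tonelli the
  -- `t`-integral and then the `y`-integral are Gamma integrals.
  have key : ENNReal.ofReal (Real.Gamma (α + β)) *
      ∫⁻ t in Set.Ioi (0 : ℝ), ENNReal.ofReal (t ^ (α - 1) * (1 + t) ^ (-(α + β)))
      = ENNReal.ofReal (Real.Gamma α * Real.Gamma β) := by
    calc _ = ∫⁻ t in Set.Ioi (0 : ℝ), ∫⁻ y in Set.Ioi (0 : ℝ),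
          ENNReal.ofReal (t ^ (α - 1) * (y ^ (α + β - 1) * Real.exp (-((1 + t) * y)))) := by
          rw [← lintegral_const_mul _ (by fun_prop)]
          refine setLIntegral_congr_fun measurableSet_Ioi fun t ht => ?_
          have ht : 0 < t := ht
          have ht1 : 0 < 1 + t := by positivity
          have h0 : 0 ≤ t ^ (α - 1) := by positivity
          simp only [ENNReal.ofReal_mul h0]
          rw [lintegral_const_mul _ (by fun_prop),
            lintegral_rpow_mul_exp_neg_mul_Ioi (add_pos hα hβ) ht1, ← ENNReal.ofReal_mul h0,
            ← ENNReal.ofReal_mul h0, ← ENNReal.ofReal_mul hΓ.le]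
          congr 1; ring
      _ = ∫⁻ y in Set.Ioi (0 : ℝ), ∫⁻ t in Set.Ioi (0 : ℝ),
          ENNReal.ofReal (t ^ (α - 1) * (y ^ (α + β - 1) * Real.exp (-((1 + t) * y)))) :=
          lintegral_lintegral_swap (by fun_prop)
      _ = ∫⁻ y in Set.Ioi (0 : ℝ),
          ENNReal.ofReal (Real.Gamma α) *
            ENNReal.ofReal (y ^ (β - 1) * Real.exp (-(1 * y))) := by
          refine setLIntegral_congr_fun measurableSet_Ioi fun y hy => ?_
          have hy : 0 < y := hy
          have h0 : 0 ≤ y ^ (α + β - 1) * Real.exp (-y) := by positivity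
          have : ∀ t : ℝ, t ^ (α - 1) * (y ^ (α + β - 1) * Real.exp (-((1 + t) * y)))
              = (y ^ (α + β - 1) * Real.exp (-y)) * (t ^ (α - 1) * Real.exp (-(y * t))) := by
            intro t
            have : -((1 + t) * y) = -y + -(y * t) := by ring
            rw [this, Real.exp_add]; ring
          simp only [this, ENNReal.ofReal_mul h0]
          rw [lintegral_const_mul _ (by fun_prop), lintegral_rpow_mul_exp_neg_mul_Ioi hα hy,
            ← ENNReal.ofReal_mul h0, ← ENNReal.ofReal_mul hΓα.le]
          have : y ^ (β - 1) = y ^ (α + β - 1) * y ^ (-α) := by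
            rw [← Real.rpow_add hy]; congr 1; ring
          rw [this, one_mul]; congr 1; ring
      _ = _ := by
          rw [lintegral_const_mul _ (by fun_prop), lintegral_rpow_mul_exp_neg_mul_Ioi hβ one_pos,
            Real.one_rpow, one_mul, ← ENNReal.ofReal_mul hΓα.le]
  rw [beta, ENNReal.ofReal_div_of_pos hΓ, ← key, mul_comm, ENNReal.mul_div_cancel_right]
  · simpa using hΓ
  · simp

lemma hasSum_one_sub_rpow_neg (m : ℝ) {x : ℝ} (hx : |x| < 1) :
    HasSum (fun k : ℕ => Ring.choose (m + k - 1) k * x ^ k) ((1 - x) ^ (-m)) := by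
  have h := (Real.one_div_one_sub_rpow_hasFPowerSeriesOnBall_zero m).hasSum (y := x)
    (by simpa [Metric.mem_eball, edist_dist, Real.dist_eq] using hx)
  have h1 : (1 - x) ^ (-m) = 1 / (1 - (0 + x)) ^ m := by
    rw [zero_add, Real.rpow_neg (by linarith [abs_lt.1 hx]), one_div]
  rw [h1]
  refine h.congr_fun fun k => ?_
  simp [FormalMultilinearSeries.ofScalars, mul_comm]

/-- The coefficient is a rising factorial of `m` over `k!`. The case `m = 0` is needed for `n = d`.
Nonnegativity allows sums and integrals to be exchanged freely in `ENNReal`. -/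
lemma choose_add_sub_one_nonneg {m : ℝ} (hm : 0 ≤ m) (k : ℕ) :
    0 ≤ Ring.choose (m + k - 1) k := by
  have h := Ring.factorial_nsmul_multichoose_eq_ascPochhammer m k
  rw [Polynomial.ascPochhammer_smeval_eq_eval] at h
  have h2 : 0 ≤ (ascPochhammer ℝ k).eval m := by
    rcases hm.eq_or_lt with rfl | hm
    · rw [ascPochhammer_eval_zero]; split_ifs <;> norm_num
    · exact (ascPochhammer_pos k m hm).le
  have h3 : Ring.choose (m + k - 1) k = Ring.multichoose m k := by
    rw [Ring.choose]; congr 1; ring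
  rw [h3]
  rw [nsmul_eq_mul] at h
  by_contra hneg
  push Not at hneg
  have : (0 : ℝ) < (k.factorial : ℝ) := by positivity
  nlinarith

lemma lintegral_rpow_mul_one_add_mul_rpow_Ioi {a r l m : ℝ} (ha : 0 < a) (ha1 : a ≤ 1)
    (hr1 : r < 1) (hm : 0 ≤ m) (hlm : 0 < l + m - 1 + r) :
    ∫⁻ t in Set.Ioi (0 : ℝ),
        ENNReal.ofReal (t ^ (-r) * ((1 + t) ^ (-l) * (1 + a ^ 2 * t) ^ (-m)))
      = ∑' k : ℕ, ENNReal.ofReal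
          ((1 - a ^ 2) ^ k * Ring.choose (m + k - 1) k
            * beta ((k : ℝ) + 1 - r) (l + m - 1 + r)) := by
  have hq : 0 ≤ 1 - a ^ 2 := by nlinarith
  have hq1 : 1 - a ^ 2 < 1 := by nlinarith
  have hc : ∀ k : ℕ, 0 ≤ (1 - a ^ 2) ^ k * Ring.choose (m + k - 1) k := fun k =>
    mul_nonneg (pow_nonneg hq k) (choose_add_sub_one_nonneg hm k)
  have hpt : ∀ t : ℝ, 0 < t →
      ENNReal.ofReal (t ^ (-r) * ((1 + t) ^ (-l) * (1 + a ^ 2 * t) ^ (-m)))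
      = ∑' k : ℕ, ENNReal.ofReal ((1 - a ^ 2) ^ k * Ring.choose (m + k - 1) k) *
        ENNReal.ofReal (t ^ ((k : ℝ) + 1 - r - 1) *
          (1 + t) ^ (-(((k : ℝ) + 1 - r) + (l + m - 1 + r)))) := by
    intro t ht
    have ht1 : 0 < 1 + t := by positivity
    -- Chosen so that `1 + a² t = (1 + t) (1 - x)` with `0 ≤ x < 1` for every `t > 0`. The series in
    -- `x` therefore converges on the whole half-line, and each of its terms is a beta integrand.
    set x := (1 - a ^ 2) * (t / (1 + t)) with hx
    have hx0 : 0 ≤ x := by positivity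
    have htt : t / (1 + t) < 1 := by rw [div_lt_one ht1]; linarith
    have htt0 : 0 < t / (1 + t) := by positivity
    have hx1 : x < 1 := by nlinarith
    have hs := (hasSum_one_sub_rpow_neg m (x := x) (by rw [abs_of_nonneg hx0]; exact hx1)).mul_left
      (t ^ (-r) * (1 + t) ^ (-(l + m)))
    have e1 : t ^ (-r) * ((1 + t) ^ (-l) * (1 + a ^ 2 * t) ^ (-m))
        = t ^ (-r) * (1 + t) ^ (-(l + m)) * (1 - x) ^ (-m) := by
      have : 1 + a ^ 2 * t = (1 + t) * (1 - x) := by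
        rw [hx]; field_simp; ring
      rw [this, Real.mul_rpow ht1.le (by linarith), neg_add, Real.rpow_add ht1]
      ring
    rw [e1, ← hs.tsum_eq, ENNReal.ofReal_tsum_of_nonneg _ hs.summable]
    · refine tsum_congr fun k => ?_
      rw [← ENNReal.ofReal_mul (hc k)]
      congr 1
      have e2 : t ^ ((k : ℝ) + 1 - r - 1) = t ^ (-r) * t ^ k := by
        rw [← Real.rpow_natCast t k, ← Real.rpow_add ht]; congr 1; ring
      have e3 : (1 + t) ^ (-(((k : ℝ) + 1 - r) + (l + m - 1 + r)))
          = (1 + t) ^ (-(l + m)) / (1 + t) ^ k := by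
        rw [← Real.rpow_natCast (1 + t) k, ← Real.rpow_sub ht1]; congr 1; ring
      rw [e2, e3, hx, mul_pow, div_pow]
      ring
    · intro k
      have := choose_add_sub_one_nonneg hm k
      positivity
  rw [setLIntegral_congr_fun measurableSet_Ioi hpt, lintegral_tsum (fun k => by fun_prop)]
  refine tsum_congr fun k => ?_
  rw [lintegral_const_mul _ (by fun_prop), lintegral_rpow_mul_one_add_rpow_Ioi _ hlm,
    ← ENNReal.ofReal_mul (hc k)]
  have : (0 : ℝ) ≤ k := by positivity
  linarith

/-- Differentiated binomial formula. -/
lemma natCast_mul_add_mul_add_pow_pred (d : ℕ) (p q P Q : ℝ) :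
    d * (P + Q) * (p + q) ^ (d - 1) = ∑ n ∈ Finset.range (d + 1), (d.choose n : ℝ) *
      (n * P * p ^ (n - 1) * q ^ (d - n) + ((d - n : ℕ) : ℝ) * Q * p ^ n * q ^ (d - n - 1)) := by
  have hlin : ∀ u v : ℝ, HasDerivAt (fun x : ℝ => u + x * v) v 0 := fun u v => by
    simpa using ((hasDerivAt_id (0 : ℝ)).mul_const v).const_add u
  -- The identity compares two derivatives at `0` of this one function, before and after binomial
  -- expansion.
  have h1 : HasDerivAt (fun x : ℝ => ((p + x * P) + (q + x * Q)) ^ d)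
      (d * (p + q) ^ (d - 1) * (P + Q)) 0 := by
    simpa using ((hlin p P).fun_add (hlin q Q)).fun_pow d
  have h2 : HasDerivAt (fun x : ℝ => ∑ n ∈ Finset.range (d + 1),
      (p + x * P) ^ n * (q + x * Q) ^ (d - n) * (d.choose n : ℝ))
      (∑ n ∈ Finset.range (d + 1), ((n * p ^ (n - 1) * P) * q ^ (d - n) +
        p ^ n * (((d - n : ℕ) : ℝ) * q ^ (d - n - 1) * Q)) * (d.choose n : ℝ)) 0 := by
    refine HasDerivAt.fun_sum fun n _ => ?_
    simpa using (((hlin p P).fun_pow n).fun_mul ((hlin q Q).fun_pow (d - n))).mul_const (d.choose n : ℝ)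
  have h3 : (fun x : ℝ => ((p + x * P) + (q + x * Q)) ^ d) = fun x : ℝ =>
      ∑ n ∈ Finset.range (d + 1),
      (p + x * P) ^ n * (q + x * Q) ^ (d - n) * (d.choose n : ℝ) := by
    funext x; exact add_pow _ _ _
  rw [h3] at h1
  have := h1.unique h2
  rw [mul_right_comm, this]
  refine Finset.sum_congr rfl fun n _ => by ring

end ReLUNet

/-! ### One-dimensional Gaussian integrals of the activation. -/

namespace ReLUNet

lemma integral_Ioi_gaussianPDFReal_mul_exp {c : ℝ} (hc : 0 < 1 + c) :
    ∫ x in Set.Ioi (0 : ℝ), gaussianPDFReal 0 1 x * Real.exp (-(c * x ^ 2 / 2))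
      = 1 / 2 * (1 + c) ^ (-(1 / 2) : ℝ) := by
  have h := integral_rpow_mul_exp_neg_mul_rpow (p := 2) (q := 0) (b := (1 + c) / 2)
    (by norm_num) (by norm_num) (by positivity)
  have e : ∀ x : ℝ, gaussianPDFReal 0 1 x * Real.exp (-(c * x ^ 2 / 2))
      = (√(2 * Real.pi))⁻¹ * (x ^ (0 : ℝ) * Real.exp (-((1 + c) / 2) * x ^ (2 : ℝ))) := by
    intro x
    simp only [gaussianPDFReal, NNReal.coe_one, mul_one, sub_zero, Real.rpow_zero, one_mul,
      Real.rpow_two]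
    rw [mul_assoc, ← Real.exp_add]
    congr 2; ring
  simp only [e]
  rw [integral_const_mul, h, zero_add, Real.Gamma_one_half_eq, Real.div_rpow hc.le (by norm_num),
    Real.sqrt_mul (by norm_num), neg_div, Real.rpow_neg (by norm_num : (0 : ℝ) ≤ 2),
    ← Real.sqrt_eq_rpow]
  have := Real.pi_pos
  field_simp

lemma integral_Ioi_gaussianPDFReal_mul_sq_mul_exp {c : ℝ} (hc : 0 < 1 + c) :
    ∫ x in Set.Ioi (0 : ℝ), gaussianPDFReal 0 1 x * (x ^ 2 * Real.exp (-(c * x ^ 2 / 2)))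
      = 1 / 2 * (1 + c) ^ (-(3 / 2) : ℝ) := by
  have h := integral_rpow_mul_exp_neg_mul_rpow (p := 2) (q := 2) (b := (1 + c) / 2)
    (by norm_num) (by norm_num) (by positivity)
  have e : ∀ x : ℝ, gaussianPDFReal 0 1 x * (x ^ 2 * Real.exp (-(c * x ^ 2 / 2)))
      = (√(2 * Real.pi))⁻¹ * (x ^ (2 : ℝ) * Real.exp (-((1 + c) / 2) * x ^ (2 : ℝ))) := by
    intro x
    simp only [gaussianPDFReal, NNReal.coe_one, mul_one, sub_zero, Real.rpow_two]
    have : -((1 + c) / 2) * x ^ 2 = -x ^ 2 / 2 + -(c * x ^ 2 / 2) := by ring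
    rw [this, Real.exp_add]
    ring
  simp only [e]
  have h2 : Real.Gamma ((2 + 1) / 2) = 1 / 2 * √Real.pi := by
    rw [show ((2 : ℝ) + 1) / 2 = 1 / 2 + 1 by norm_num, Real.Gamma_add_one (by norm_num),
      Real.Gamma_one_half_eq]
  have h3 : (2 : ℝ) ^ (3 / 2 : ℝ) = 2 * √2 := by
    rw [show (3 / 2 : ℝ) = 1 + 1 / 2 by norm_num, Real.rpow_add (by norm_num), Real.rpow_one,
      ← Real.sqrt_eq_rpow]
  rw [integral_const_mul, h, h2, show (-((2 : ℝ) + 1) / 2) = -(3 / 2) by norm_num,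
    Real.div_rpow hc.le (by norm_num),
    Real.sqrt_mul (by norm_num), Real.rpow_neg (by norm_num : (0 : ℝ) ≤ 2), h3]
  have := Real.pi_pos
  field_simp

/-- The activation is linear on each half-line; folding the negative one over leaves two plain
Gaussian integrals on `(0, ∞)`. -/
lemma integral_gaussianReal_eq_add_Ioi {f : ℝ → ℝ} (hf : Integrable f (gaussianReal 0 1)) :
    ∫ x, f x ∂(gaussianReal 0 1) = (∫ x in Set.Ioi (0 : ℝ), gaussianPDFReal 0 1 x * f x)
      + ∫ x in Set.Ioi (0 : ℝ), gaussianPDFReal 0 1 x * f (-x) := by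
  have h : ∀ s : Set ℝ, MeasurableSet s →
      ∫ x in s, f x ∂(gaussianReal 0 1) = ∫ x in s, gaussianPDFReal 0 1 x * f x := by
    intro s hs
    rw [← integral_indicator hs, integral_gaussianReal_eq_integral_smul one_ne_zero,
      ← integral_indicator hs]
    congr 1; ext x
    by_cases hx : x ∈ s <;> simp [hx]
  rw [← integral_add_compl (measurableSet_Ioi (a := (0 : ℝ))) hf, h _ measurableSet_Ioi,
    h _ measurableSet_Ioi.compl, Set.compl_Ioi]
  congr 1
  have := integral_comp_neg_Ioi (0 : ℝ) (fun x => gaussianPDFReal 0 1 x * f x)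
  rw [neg_zero] at this
  rw [← this]
  simp [gaussianPDFReal]

lemma measurable_act (a : ℝ) : Measurable (act a) :=
  Measurable.ite measurableSet_Ioi measurable_id (by fun_prop)

lemma act_of_pos (a : ℝ) {x : ℝ} (hx : 0 < x) : act a x = x := if_pos hx

lemma act_of_nonpos (a : ℝ) {x : ℝ} (hx : x ≤ 0) : act a x = a * x := if_neg hx.not_gt

lemma act_mul_of_nonneg (a : ℝ) {c : ℝ} (hc : 0 ≤ c) (x : ℝ) : act a (c * x) = c * act a x := by
  rcases hc.eq_or_lt with rfl | hc
  · simp [act]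
  · simp only [act, mul_pos_iff_of_pos_left hc]
    split_ifs <;> ring

lemma sq_act_le {a : ℝ} (ha : 0 ≤ a) (ha1 : a ≤ 1) (x : ℝ) : act a x ^ 2 ≤ x ^ 2 := by
  unfold act
  split_ifs
  · rfl
  · rw [mul_pow]
    exact mul_le_of_le_one_left (sq_nonneg x) (pow_le_one₀ ha ha1)

lemma sq_mul_sq_le_sq_act {a : ℝ} (ha : 0 ≤ a) (ha1 : a ≤ 1) (x : ℝ) :
    a ^ 2 * x ^ 2 ≤ act a x ^ 2 := by
  unfold act
  split_ifs
  · exact mul_le_of_le_one_left (sq_nonneg x) (pow_le_one₀ ha ha1)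
  · rw [mul_pow]

lemma integrable_exp_neg_mul_sq_act (a : ℝ) {t : ℝ} (ht : 0 ≤ t) :
    Integrable (fun x => Real.exp (-(t * act a x ^ 2 / 2))) (gaussianReal 0 1) := by
  have := measurable_act a
  refine Integrable.of_bound (C := 1) (by fun_prop) (ae_of_all _ fun x => ?_)
  rw [Real.norm_eq_abs, Real.abs_exp]
  exact Real.exp_le_one_iff.2 (by rw [neg_nonpos]; positivity)

lemma integrable_sq_act_mul_exp {a : ℝ} (ha : 0 ≤ a) (ha1 : a ≤ 1) {t : ℝ} (ht : 0 ≤ t) :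
    Integrable (fun x => act a x ^ 2 * Real.exp (-(t * act a x ^ 2 / 2))) (gaussianReal 0 1) := by
  have := measurable_act a
  have h2 : Integrable (fun x : ℝ => x ^ 2) (gaussianReal 0 1) :=
    (memLp_id_gaussianReal (μ := 0) (v := 1) 2).integrable_sq
  refine h2.mono' (by fun_prop) (ae_of_all _ fun x => ?_)
  have h1 : Real.exp (-(t * act a x ^ 2 / 2)) ≤ 1 :=
    Real.exp_le_one_iff.2 (by rw [neg_nonpos]; positivity)
  rw [Real.norm_of_nonneg (by positivity)]
  calc _ ≤ act a x ^ 2 * 1 := by gcongr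
    _ ≤ x ^ 2 := by rw [mul_one]; exact sq_act_le ha ha1 x

lemma integral_exp_neg_mul_sq_act (a : ℝ) {t : ℝ} (ht : 0 ≤ t) :
    ∫ x, Real.exp (-(t * act a x ^ 2 / 2)) ∂(gaussianReal 0 1)
      = 1 / 2 * ((1 + t) ^ (-(1 / 2) : ℝ) + (1 + a ^ 2 * t) ^ (-(1 / 2) : ℝ)) := by
  rw [integral_gaussianReal_eq_add_Ioi (integrable_exp_neg_mul_sq_act a ht), mul_add,
    ← integral_Ioi_gaussianPDFReal_mul_exp (by positivity : 0 < 1 + t),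
    ← integral_Ioi_gaussianPDFReal_mul_exp (by positivity : 0 < 1 + a ^ 2 * t)]
  congr 1
  · refine setIntegral_congr_fun measurableSet_Ioi fun x hx => ?_
    simp only [act_of_pos a hx]
  · refine setIntegral_congr_fun measurableSet_Ioi fun x hx => ?_
    have hx : 0 < x := hx
    simp only [act_of_nonpos a (neg_nonpos.2 hx.le)]
    congr 2; ring

lemma integral_sq_act_mul_exp {a : ℝ} (ha : 0 ≤ a) (ha1 : a ≤ 1) {t : ℝ} (ht : 0 ≤ t) :
    ∫ x, act a x ^ 2 * Real.exp (-(t * act a x ^ 2 / 2)) ∂(gaussianReal 0 1)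
      = 1 / 2 * ((1 + t) ^ (-(3 / 2) : ℝ) + a ^ 2 * (1 + a ^ 2 * t) ^ (-(3 / 2) : ℝ)) := by
  rw [integral_gaussianReal_eq_add_Ioi (integrable_sq_act_mul_exp ha ha1 ht), mul_add,
    mul_left_comm (1 / 2) (a ^ 2),
    ← integral_Ioi_gaussianPDFReal_mul_sq_mul_exp (by positivity : 0 < 1 + t),
    ← integral_Ioi_gaussianPDFReal_mul_sq_mul_exp (by positivity : 0 < 1 + a ^ 2 * t),
    ← integral_const_mul]
  congr 1
  · refine setIntegral_congr_fun measurableSet_Ioi fun x hx => ?_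
    simp only [act_of_pos a hx]
  · refine setIntegral_congr_fun measurableSet_Ioi fun x hx => ?_
    have hx : 0 < x := hx
    simp only [act_of_nonpos a (neg_nonpos.2 hx.le)]
    have : -(t * (a * -x) ^ 2 / 2) = -(a ^ 2 * t * x ^ 2 / 2) := by ring
    rw [this]; ring

end ReLUNet

/-! ### Moments of `‖φ_a(z)‖` and the explicit series. -/

namespace ReLUNet

variable {d : ℕ}

lemma measurable_actVec (a : ℝ) : Measurable (actVec a : EuclideanSpace ℝ (Fin d) → _) := by
  have := measurable_act a
  unfold actVec
  fun_prop

lemma norm_sq_actVec (a : ℝ) (z : EuclideanSpace ℝ (Fin d)) :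
    ‖actVec a z‖ ^ 2 = ∑ i, act a (z i) ^ 2 := by
  simp [EuclideanSpace.norm_sq_eq, actVec]

lemma norm_actVec_le {a : ℝ} (ha : 0 ≤ a) (ha1 : a ≤ 1) (z : EuclideanSpace ℝ (Fin d)) :
    ‖actVec a z‖ ≤ ‖z‖ := by
  refine (sq_le_sq₀ (norm_nonneg _) (norm_nonneg _)).1 ?_
  rw [norm_sq_actVec, EuclideanSpace.norm_sq_eq]
  exact Finset.sum_le_sum fun i _ => by simpa using sq_act_le ha ha1 (z i)

lemma mul_norm_le_norm_actVec {a : ℝ} (ha : 0 ≤ a) (ha1 : a ≤ 1)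
    (z : EuclideanSpace ℝ (Fin d)) : a * ‖z‖ ≤ ‖actVec a z‖ := by
  refine (sq_le_sq₀ (by positivity) (norm_nonneg _)).1 ?_
  rw [norm_sq_actVec, mul_pow, EuclideanSpace.norm_sq_eq, Finset.mul_sum]
  exact Finset.sum_le_sum fun i _ => by simpa using sq_mul_sq_le_sq_act ha ha1 (z i)

lemma actVec_smul_of_nonneg (a : ℝ) {c : ℝ} (hc : 0 ≤ c) (z : EuclideanSpace ℝ (Fin d)) :
    actVec a (c • z) = c • actVec a z := by
  ext i
  simp [actVec, act_mul_of_nonneg a hc]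

lemma integrable_norm_rpow_stdGaussian {s : ℝ} (hs : 0 < s) :
    Integrable (fun z => ‖z‖ ^ s) (stdGaussian (EuclideanSpace ℝ (Fin d))) := by
  have h := (IsGaussian.memLp_id (stdGaussian (EuclideanSpace ℝ (Fin d))) (ENNReal.ofReal s)
    (by simp)).integrable_norm_rpow (by simpa using hs) (by simp)
  simpa [ENNReal.toReal_ofReal hs.le] using h

lemma integrable_norm_actVec_rpow {a : ℝ} (ha : 0 ≤ a) (ha1 : a ≤ 1) {s : ℝ} (hs : 0 < s) :
    Integrable (fun z => ‖actVec a z‖ ^ s) (stdGaussian (EuclideanSpace ℝ (Fin d))) := by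
  have := measurable_actVec (d := d) a
  refine (integrable_norm_rpow_stdGaussian hs).mono'
    (this.norm.pow_const s).aestronglyMeasurable (ae_of_all _ fun z => ?_)
  rw [Real.norm_of_nonneg (by positivity)]
  exact Real.rpow_le_rpow (norm_nonneg _) (norm_actVec_le ha ha1 z) hs.le

/-- The squared norm is a sum and the exponential a product over coordinates. Each summand is thus a
product of one-variable functions, and its Gaussian integral factorizes. -/
lemma norm_sq_mul_exp_actVec_toLp (a t : ℝ) (x : Fin d → ℝ) :
    ‖actVec a (WithLp.toLp 2 x)‖ ^ 2 * Real.exp (-(t * ‖actVec a (WithLp.toLp 2 x)‖ ^ 2 / 2))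
      = ∑ i, ∏ j, (if j = i then fun y => act a y ^ 2 * Real.exp (-(t * act a y ^ 2 / 2))
          else fun y => Real.exp (-(t * act a y ^ 2 / 2))) (x j) := by
  rw [norm_sq_actVec, Finset.sum_mul]
  refine Finset.sum_congr rfl fun i _ => ?_
  have h1 : Real.exp (-(t * (∑ j, act a (x j) ^ 2) / 2))
      = ∏ j, Real.exp (-(t * act a (x j) ^ 2 / 2)) := by
    rw [← Real.exp_sum, Finset.sum_neg_distrib, ← Finset.sum_div, ← Finset.mul_sum]
  have h2 : act a (x i) ^ 2 = ∏ j, if j = i then act a (x j) ^ 2 else 1 := by simp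
  simp only [h1]
  rw [h2, ← Finset.prod_mul_distrib]
  refine Finset.prod_congr rfl fun j _ => ?_
  split_ifs <;> simp

lemma integrable_norm_sq_mul_exp_actVec {a : ℝ} (ha : 0 ≤ a) (ha1 : a ≤ 1) {t : ℝ} (ht : 0 ≤ t) :
    Integrable (fun z => ‖actVec a z‖ ^ 2 * Real.exp (-(t * ‖actVec a z‖ ^ 2 / 2)))
      (stdGaussian (EuclideanSpace ℝ (Fin d))) := by
  have := measurable_actVec (d := d) a
  have h2 := integrable_norm_actVec_rpow (d := d) ha ha1 (s := 2) two_pos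
  refine h2.mono' (by fun_prop) (ae_of_all _ fun x => ?_)
  have h1 : Real.exp (-(t * ‖actVec a x‖ ^ 2 / 2)) ≤ 1 :=
    Real.exp_le_one_iff.2 (by rw [neg_nonpos]; positivity)
  rw [Real.norm_of_nonneg (by positivity), Real.rpow_two]
  exact mul_le_of_le_one_right (by positivity) h1

lemma integral_norm_sq_mul_exp_actVec {a : ℝ} (ha : 0 ≤ a) (ha1 : a ≤ 1) {t : ℝ} (ht : 0 ≤ t) :
    ∫ z, ‖actVec a z‖ ^ 2 * Real.exp (-(t * ‖actVec a z‖ ^ 2 / 2))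
        ∂(stdGaussian (EuclideanSpace ℝ (Fin d)))
      = d * (1 / 2 * ((1 + t) ^ (-(3 / 2) : ℝ) + a ^ 2 * (1 + a ^ 2 * t) ^ (-(3 / 2) : ℝ))) *
        (1 / 2 * ((1 + t) ^ (-(1 / 2) : ℝ) + (1 + a ^ 2 * t) ^ (-(1 / 2) : ℝ))) ^ (d - 1) := by
  have hm := measurable_actVec (d := d) a
  rw [← map_pi_eq_stdGaussian, integral_map (by fun_prop) (by fun_prop)]
  simp only [norm_sq_mul_exp_actVec_toLp]
  rw [integral_finsetSum]
  · simp only [integral_fintype_prod_eq_prod]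
    have : ∀ i : Fin d, ∏ j, ∫ x, (if j = i then
          fun y => act a y ^ 2 * Real.exp (-(t * act a y ^ 2 / 2))
          else fun y => Real.exp (-(t * act a y ^ 2 / 2))) x ∂(gaussianReal 0 1)
        = (1 / 2 * ((1 + t) ^ (-(3 / 2) : ℝ) + a ^ 2 * (1 + a ^ 2 * t) ^ (-(3 / 2) : ℝ))) *
        (1 / 2 * ((1 + t) ^ (-(1 / 2) : ℝ) + (1 + a ^ 2 * t) ^ (-(1 / 2) : ℝ))) ^ (d - 1) := by
      intro i
      rw [← Finset.mul_prod_erase _ _ (Finset.mem_univ i), if_pos rfl,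
        integral_sq_act_mul_exp ha ha1 ht]
      congr 1
      rw [Finset.prod_congr rfl (g := fun _ =>
        1 / 2 * ((1 + t) ^ (-(1 / 2) : ℝ) + (1 + a ^ 2 * t) ^ (-(1 / 2) : ℝ)))]
      · simp
      · intro j hj
        rw [if_neg (Finset.ne_of_mem_erase hj), integral_exp_neg_mul_sq_act a ht]
    simp only [this]
    simp
    ring
  · intro i _
    refine Integrable.fintype_prod fun j => ?_
    split_ifs
    · exact integrable_sq_act_mul_exp ha ha1 ht
    · exact integrable_exp_neg_mul_sq_act a ht

/-- Binomial expansion in which `n` counts the positive coordinates: these contribute powers of `1 +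
t`, the others powers of `1 + a² t`. -/
lemma integral_norm_sq_mul_exp_actVec_eq_sum {a : ℝ} (ha : 0 ≤ a) (ha1 : a ≤ 1) {t : ℝ}
    (ht : 0 ≤ t) :
    ∫ z, ‖actVec a z‖ ^ 2 * Real.exp (-(t * ‖actVec a z‖ ^ 2 / 2))
        ∂(stdGaussian (EuclideanSpace ℝ (Fin d)))
      = ∑ n ∈ Finset.range (d + 1), (d.choose n : ℝ) * (1 / 2 ^ d) *
        (n * ((1 + t) ^ (-((n : ℝ) / 2 + 1)) * (1 + a ^ 2 * t) ^ (-(((d : ℝ) - n) / 2)))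
          + a ^ 2 * ((d : ℝ) - n) *
            ((1 + t) ^ (-((n : ℝ) / 2)) * (1 + a ^ 2 * t) ^ (-(((d : ℝ) - n) / 2 + 1)))) := by
  rw [integral_norm_sq_mul_exp_actVec ha ha1 ht]
  set u := 1 + t with hu
  set v := 1 + a ^ 2 * t with hv
  have hu0 : 0 < u := by positivity
  have hv0 : 0 < v := by positivity
  have e1 : (d : ℝ) * (1 / 2 * (u ^ (-(3 / 2) : ℝ) + a ^ 2 * v ^ (-(3 / 2) : ℝ))) *
        (1 / 2 * (u ^ (-(1 / 2) : ℝ) + v ^ (-(1 / 2) : ℝ))) ^ (d - 1)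
      = (1 / 2 ^ d) * (d * (u ^ (-(3 / 2) : ℝ) + a ^ 2 * v ^ (-(3 / 2) : ℝ)) *
        (u ^ (-(1 / 2) : ℝ) + v ^ (-(1 / 2) : ℝ)) ^ (d - 1)) := by
    -- For `d = 0` the exponent `d - 1` is truncated, but the factor `d` kills both sides.
    rcases d with _ | e
    · simp
    · simp only [Nat.add_sub_cancel, mul_pow, one_div, inv_pow, pow_succ]
      ring
  rw [e1, natCast_mul_add_mul_add_pow_pred, Finset.mul_sum]
  refine Finset.sum_congr rfl fun n hn => ?_
  have hn : n ≤ d := Nat.lt_succ_iff.1 (Finset.mem_range.1 hn)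
  have hpow : ∀ w : ℝ, 0 < w → ∀ k : ℕ, (w ^ (-(1 / 2) : ℝ)) ^ k = w ^ (-((k : ℝ) / 2)) := by
    intro w hw k
    rw [← Real.rpow_natCast, ← Real.rpow_mul hw.le]; congr 1; ring
  have hpred : ∀ w : ℝ, 0 < w → ∀ k : ℕ,
      (k : ℝ) * w ^ (-(3 / 2) : ℝ) * (w ^ (-(1 / 2) : ℝ)) ^ (k - 1)
        = k * w ^ (-((k : ℝ) / 2 + 1)) := by
    intro w hw k
    rcases k with _ | k
    · simp
    · rw [Nat.add_sub_cancel, hpow w hw, mul_assoc, ← Real.rpow_add hw]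
      congr 2; push_cast; ring
  have h1 := hpred u hu0 n
  have h2 := hpred v hv0 (d - n)
  rw [← Nat.cast_sub hn, ← hpow u hu0, ← hpow v hv0]
  linear_combination (1 / 2 ^ d * (d.choose n : ℝ) * (v ^ (-(1 / 2) : ℝ)) ^ (d - n)) * h1 +
    (1 / 2 ^ d * (d.choose n : ℝ) * a ^ 2 * (u ^ (-(1 / 2) : ℝ)) ^ n) * h2

/-- This trades `xˢ` for exponentials in `x²`. The factor `x²` is kept because `t^(-s/2-1) exp (-t
x²/2)` is not integrable at `0`; with it the Gamma parameter is `1 - s/2`, whence `s < 2`. -/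
lemma lintegral_rpow_mul_sq_mul_exp {s x : ℝ} (hs : 0 < s) (hs2 : s < 2) (hx : 0 ≤ x) :
    ∫⁻ t in Set.Ioi (0 : ℝ),
        ENNReal.ofReal (t ^ (-(s / 2)) * (x ^ 2 * Real.exp (-(t * x ^ 2 / 2))))
      = ENNReal.ofReal (2 ^ (1 - s / 2) * Real.Gamma (1 - s / 2)) * ENNReal.ofReal (x ^ s) := by
  rcases hx.eq_or_lt with rfl | hx
  · simp [Real.zero_rpow hs.ne']
  · have h := lintegral_rpow_mul_exp_neg_mul_Ioi (c := 1 - s / 2) (y := x ^ 2 / 2)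
      (by linarith) (by positivity)
    have hΓ : 0 < Real.Gamma (1 - s / 2) := Real.Gamma_pos_of_pos (by linarith)
    have e : ∀ t : ℝ, ENNReal.ofReal (t ^ (-(s / 2)) * (x ^ 2 * Real.exp (-(t * x ^ 2 / 2))))
        = ENNReal.ofReal (x ^ 2) *
          ENNReal.ofReal (t ^ (1 - s / 2 - 1) * Real.exp (-(x ^ 2 / 2 * t))) := by
      intro t
      rw [← ENNReal.ofReal_mul (by positivity)]
      have h1 : 1 - s / 2 - 1 = -(s / 2) := by ring
      have h2 : x ^ 2 / 2 * t = t * x ^ 2 / 2 := by ring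
      rw [h1, h2]; congr 1; ring
    simp only [e]
    rw [lintegral_const_mul _ (by fun_prop), h, ← ENNReal.ofReal_mul (by positivity),
      ← ENNReal.ofReal_mul (by positivity)]
    congr 1
    rw [Real.div_rpow (by positivity) (by norm_num), Real.rpow_neg (by norm_num : (0 : ℝ) ≤ 2),
      ← Real.rpow_natCast x 2, ← Real.rpow_mul hx.le]
    have h3 : x ^ s = x ^ ((2 : ℕ) : ℝ) * x ^ (((2 : ℕ) : ℝ) * -(1 - s / 2)) := by
      rw [← Real.rpow_add hx]; congr 1; push_cast; ring
    rw [h3]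
    field_simp

lemma weight_mul_beta_nonneg {a s : ℝ} (ha : 0 ≤ a) (ha1 : a ≤ 1) (hs : 0 < s) (hs2 : s < 2)
    {n : ℕ} (hn : n ≤ d) (k : ℕ) :
    0 ≤ weight a d k n * beta ((k : ℝ) + 1 - s / 2) ((d : ℝ) / 2 + s / 2) := by
  have hn' : (n : ℝ) ≤ d := by exact_mod_cast hn
  have h1 := choose_add_sub_one_nonneg (m := ((d : ℝ) - n) / 2) (by linarith) k
  have h2 := choose_add_sub_one_nonneg (m := ((d : ℝ) - n) / 2 + 1) (by linarith) k
  rw [show ((d : ℝ) - n) / 2 + 1 + k - 1 = ((d : ℝ) - n) / 2 + k by ring] at h2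
  have hk : (0 : ℝ) ≤ k := by positivity
  have hd : (0 : ℝ) ≤ d := by positivity
  have h3 : 0 < beta ((k : ℝ) + 1 - s / 2) ((d : ℝ) / 2 + s / 2) :=
    beta_pos (by linarith) (by linarith)
  have h4 : 0 ≤ 1 - a ^ 2 := by nlinarith
  have h5 : 0 ≤ (d : ℝ) - n := by linarith
  unfold weight
  positivity

/-- The two terms for each `n` have exponents `(n/2+1, (d-n)/2)` and `(n/2, (d-n)/2+1)`. Their sums
agree, so both produce the same beta value and merge into one weight; the `2` cancels the `1/2` in
`weight`. -/
lemma lintegral_rpow_mul_integral_norm_sq_mul_exp {a s : ℝ} (ha : 0 < a) (ha1 : a ≤ 1)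
    (hs : 0 < s) (hs2 : s < 2) :
    ∫⁻ t in Set.Ioi (0 : ℝ), ENNReal.ofReal (t ^ (-(s / 2)) *
        ∫ z, ‖actVec a z‖ ^ 2 * Real.exp (-(t * ‖actVec a z‖ ^ 2 / 2))
        ∂(stdGaussian (EuclideanSpace ℝ (Fin d))))
      = ∑ n ∈ Finset.range (d + 1), ENNReal.ofReal ((d.choose n : ℝ) * (1 / 2 ^ d)) *
        ∑' k : ℕ, ENNReal.ofReal
          (2 * (weight a d k n * beta ((k : ℝ) + 1 - s / 2) ((d : ℝ) / 2 + s / 2))) := by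
  have hd : (0 : ℝ) ≤ d := by positivity
  have hpt : ∀ t : ℝ, 0 < t → ENNReal.ofReal (t ^ (-(s / 2)) *
        ∫ z, ‖actVec a z‖ ^ 2 * Real.exp (-(t * ‖actVec a z‖ ^ 2 / 2))
        ∂(stdGaussian (EuclideanSpace ℝ (Fin d))))
      = ∑ n ∈ Finset.range (d + 1), ENNReal.ofReal ((d.choose n : ℝ) * (1 / 2 ^ d)) *
        (ENNReal.ofReal n * ENNReal.ofReal (t ^ (-(s / 2)) *
          ((1 + t) ^ (-((n : ℝ) / 2 + 1)) * (1 + a ^ 2 * t) ^ (-(((d : ℝ) - n) / 2))))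
          + ENNReal.ofReal (a ^ 2 * ((d : ℝ) - n)) * ENNReal.ofReal (t ^ (-(s / 2)) *
            ((1 + t) ^ (-((n : ℝ) / 2)) * (1 + a ^ 2 * t) ^ (-(((d : ℝ) - n) / 2 + 1))))) := by
    intro t ht
    have hnn : ∀ n ∈ Finset.range (d + 1), (0 : ℝ) ≤ (d : ℝ) - n := fun n hn => by
      have : (n : ℝ) ≤ d := by exact_mod_cast Nat.lt_succ_iff.1 (Finset.mem_range.1 hn)
      linarith
    rw [integral_norm_sq_mul_exp_actVec_eq_sum ha.le ha1 ht.le, Finset.mul_sum,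
      ENNReal.ofReal_sum_of_nonneg]
    · refine Finset.sum_congr rfl fun n hn => ?_
      have := hnn n hn
      rw [← ENNReal.ofReal_mul (by positivity), ← ENNReal.ofReal_mul (by positivity),
        ← ENNReal.ofReal_add (by positivity) (by positivity),
        ← ENNReal.ofReal_mul (by positivity)]
      congr 1; ring
    · intro n hn
      have := hnn n hn
      positivity
  rw [setLIntegral_congr_fun measurableSet_Ioi hpt, lintegral_finsetSum _ (fun n _ => by fun_prop)]
  refine Finset.sum_congr rfl fun n hn => ?_
  have hn' : n ≤ d := Nat.lt_succ_iff.1 (Finset.mem_range.1 hn)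
  have hnd : (n : ℝ) ≤ d := by exact_mod_cast hn'
  have hn0 : (0 : ℝ) ≤ n := by positivity
  rw [lintegral_const_mul _ (by fun_prop), lintegral_add_left (by fun_prop),
    lintegral_const_mul _ (by fun_prop), lintegral_const_mul _ (by fun_prop),
    lintegral_rpow_mul_one_add_mul_rpow_Ioi ha ha1 (by linarith) (by linarith) (by linarith),
    lintegral_rpow_mul_one_add_mul_rpow_Ioi ha ha1 (by linarith) (by linarith) (by linarith),
    ← ENNReal.tsum_mul_left, ← ENNReal.tsum_mul_left, ← ENNReal.tsum_add]
  congr 1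
  refine tsum_congr fun k => ?_
  have hk : (0 : ℝ) ≤ k := by positivity
  have e1 : (n : ℝ) / 2 + 1 + ((d : ℝ) - n) / 2 - 1 + s / 2 = (d : ℝ) / 2 + s / 2 := by ring
  have e2 : (n : ℝ) / 2 + (((d : ℝ) - n) / 2 + 1) - 1 + s / 2 = (d : ℝ) / 2 + s / 2 := by ring
  have e3 : ((d : ℝ) - n) / 2 + 1 + k - 1 = ((d : ℝ) - n) / 2 + k := by ring
  have h1 := choose_add_sub_one_nonneg (m := ((d : ℝ) - n) / 2) (by linarith) k
  have h2 := choose_add_sub_one_nonneg (m := ((d : ℝ) - n) / 2 + 1) (by linarith) k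
  rw [e3] at h2
  have h3 : 0 < beta ((k : ℝ) + 1 - s / 2) ((d : ℝ) / 2 + s / 2) :=
    beta_pos (by linarith) (by linarith)
  have h4 : 0 ≤ 1 - a ^ 2 := by nlinarith
  have h5 : 0 ≤ (d : ℝ) - n := by linarith
  rw [e1, e2, e3, ← ENNReal.ofReal_mul hn0, ← ENNReal.ofReal_mul (by positivity),
    ← ENNReal.ofReal_add (by positivity) (by positivity)]
  congr 1
  unfold weight
  ring

/-- The explicit series is the moment of order `s ∈ (0, 2)`. -/
lemma momentSeries_eq_integral {a s : ℝ} (ha : 0 < a) (ha1 : a ≤ 1) (hs : 0 < s) (hs2 : s < 2) :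
    momentSeries a s d = ∫ z, ‖actVec a z‖ ^ s ∂(stdGaussian (EuclideanSpace ℝ (Fin d))) := by
  have hm := measurable_actVec (d := d) a
  have hΓ : 0 < Real.Gamma (1 - s / 2) := Real.Gamma_pos_of_pos (by linarith)
  set E := ∫ z, ‖actVec a z‖ ^ s ∂(stdGaussian (EuclideanSpace ℝ (Fin d))) with hE
  have hE0 : 0 ≤ E := integral_nonneg fun z => by positivity
  have key : ENNReal.ofReal (2 ^ (1 - s / 2) * Real.Gamma (1 - s / 2) * E)
      = ∑ n ∈ Finset.range (d + 1), ENNReal.ofReal ((d.choose n : ℝ) * (1 / 2 ^ d)) *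
        ∑' k : ℕ, ENNReal.ofReal
          (2 * (weight a d k n * beta ((k : ℝ) + 1 - s / 2) ((d : ℝ) / 2 + s / 2))) := by
    rw [← lintegral_rpow_mul_integral_norm_sq_mul_exp ha ha1 hs hs2,
      ENNReal.ofReal_mul (by positivity), hE,
      ofReal_integral_eq_lintegral_ofReal (integrable_norm_actVec_rpow ha.le ha1 hs)
        (ae_of_all _ fun z => by positivity), ← lintegral_const_mul _ (by fun_prop)]
    simp only [← lintegral_rpow_mul_sq_mul_exp hs hs2 (norm_nonneg _)]
    rw [lintegral_lintegral_swap (by fun_prop)]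
    refine setLIntegral_congr_fun measurableSet_Ioi fun t ht => ?_
    have ht : 0 < t := ht
    rw [ENNReal.ofReal_mul (by positivity), ofReal_integral_eq_lintegral_ofReal
      (integrable_norm_sq_mul_exp_actVec ha.le ha1 ht.le) (ae_of_all _ fun z => by positivity),
      ← lintegral_const_mul _ (by fun_prop)]
    refine lintegral_congr fun z => ?_
    rw [← ENNReal.ofReal_mul (by positivity)]
  -- `ENNReal.toReal` is additive only over finite terms; finiteness comes from that of the moment.
  have hfin := key.symm.trans_ne ENNReal.ofReal_ne_top
  have h := congrArg ENNReal.toReal key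
  rw [ENNReal.toReal_ofReal (by positivity), ENNReal.toReal_sum] at h
  · have h' : 2 ^ (1 - s / 2) * Real.Gamma (1 - s / 2) * E
        = 2 * ∑ n ∈ Finset.range (d + 1), (d.choose n : ℝ) * (1 / 2 ^ d) *
      ∑' k : ℕ, weight a d k n * beta ((k : ℝ) + 1 - s / 2) ((d : ℝ) / 2 + s / 2) := by
      rw [h, Finset.mul_sum]
      refine Finset.sum_congr rfl fun n hn => ?_
      have hn : n ≤ d := Nat.lt_succ_iff.1 (Finset.mem_range.1 hn)
      rw [ENNReal.toReal_mul, ENNReal.toReal_ofReal (by positivity),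
        ENNReal.tsum_toReal_eq (fun _ => ENNReal.ofReal_ne_top), mul_left_comm 2]
      congr 1
      rw [← tsum_mul_left]
      refine tsum_congr fun k => ENNReal.toReal_ofReal ?_
      exact mul_nonneg two_pos.le (weight_mul_beta_nonneg ha.le ha1 hs hs2 hn k)
    rw [momentSeries]
    set S := ∑ n ∈ Finset.range (d + 1), (d.choose n : ℝ) * (1 / 2 ^ d) *
      ∑' k : ℕ, weight a d k n * beta ((k : ℝ) + 1 - s / 2) ((d : ℝ) / 2 + s / 2)
    have h2 : (2 : ℝ) ^ (1 - s / 2) = 2 / 2 ^ (s / 2) := by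
      rw [Real.rpow_sub two_pos, Real.rpow_one]
    have h3 : (0 : ℝ) < 2 ^ (s / 2) := by positivity
    rw [h2] at h'
    generalize Real.Gamma (1 - s / 2) = G at *
    field_simp at h' ⊢
    linarith
  · exact ENNReal.sum_ne_top.1 hfin

/-- The constant `I_a(s,d)` is the moment of order `s` for every `s > 0`. -/
lemma momentConst_eq_integral {a s : ℝ} (ha : 0 < a) (ha1 : a ≤ 1) (hs : 0 < s) :
    momentConst a s d = ∫ z, ‖actVec a z‖ ^ s ∂(stdGaussian (EuclideanSpace ℝ (Fin d))) := by
  rw [momentConst]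
  split_ifs with h1 h2
  · exact momentSeries_eq_integral ha ha1 hs h1
  · have h := integral_norm_sq_mul_exp_actVec (d := d) ha.le ha1 le_rfl
    subst h2
    simp only [Real.rpow_two]
    norm_num at h
    rw [h]; ring
  · rfl

end ReLUNet

/-! ### Moment generating function of the log growth factor. -/

namespace ReLUNet

section Exponents

variable {α : Type*} {mα : MeasurableSpace α} {ν : Measure α} {L : α → ℝ}

lemma integral_pos_of_measure_support_pos {f : α → ℝ} (hf : Integrable f ν) (hf0 : ∀ x, 0 ≤ f x)
    {s : Set α} (hs : 0 < ν s) (hfs : ∀ x ∈ s, f x ≠ 0) : 0 < ∫ x, f x ∂ν :=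
  (integral_pos_iff_support_of_nonneg hf0 hf).2 (hs.trans_le (measure_mono hfs))

variable [IsProbabilityMeasure ν]

/-- Integrate `exp (s L) ≥ s L + 1`, which is strict where `L ≠ 0`. -/
lemma integral_neg_of_mgf_eq_one (hL : Integrable L ν) {s : ℝ} (hs : 0 < s)
    (hint : Integrable (fun x => Real.exp (s * L x)) ν) (hne : 0 < ν {x | L x ≠ 0})
    (h1 : mgf L ν s = 1) : ∫ x, L x ∂ν < 0 := by
  have hp : 0 < ∫ x, (Real.exp (s * L x) - (s * L x + 1)) ∂ν := by
    refine integral_pos_of_measure_support_pos (hint.sub ((hL.const_mul s).add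
      (integrable_const 1))) (fun x => sub_nonneg.2 (Real.add_one_le_exp _)) hne fun x hx => ?_
    exact (sub_pos.2 (Real.add_one_lt_exp (mul_ne_zero hs.ne' hx))).ne'
  have hi : Integrable (fun x => s * L x + 1) ν := (hL.const_mul s).add (integrable_const 1)
  rw [integral_sub hint hi,
    integral_add (hL.const_mul s) (integrable_const 1), integral_const_mul] at hp
  rw [mgf] at h1
  simp only [h1, integral_const, probReal_univ, smul_eq_mul, mul_one] at hp
  nlinarith

lemma one_lt_mgf_of_integral_pos (hL : Integrable L ν) {s : ℝ} (hs : 0 < s)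
    (hint : Integrable (fun x => Real.exp (s * L x)) ν) (h : 0 < ∫ x, L x ∂ν) :
    1 < mgf L ν s := by
  have hle : ∫ x, (s * L x + 1) ∂ν ≤ mgf L ν s :=
    integral_mono ((hL.const_mul s).add (integrable_const 1)) hint
      fun x => Real.add_one_le_exp _
  rw [integral_add (hL.const_mul s) (integrable_const 1), integral_const_mul] at hle
  simp only [integral_const, probReal_univ, smul_eq_mul, mul_one] at hle
  nlinarith

/-- Strict convexity of `exp` between `0` and `s L`, with weight `p / s`, integrated. -/
lemma mgf_lt_one_of_lt {p s : ℝ} (hp : 0 < p) (hps : p < s)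
    (hintp : Integrable (fun x => Real.exp (p * L x)) ν)
    (hint : Integrable (fun x => Real.exp (s * L x)) ν) (hne : 0 < ν {x | L x ≠ 0})
    (h1 : mgf L ν s = 1) : mgf L ν p < 1 := by
  have hs : 0 < s := hp.trans hps
  have hθ0 : 0 < p / s := by positivity
  have hθ1 : 0 < 1 - p / s := by rw [sub_pos, div_lt_one hs]; exact hps
  have hlt : ∀ x, L x ≠ 0 → Real.exp (p * L x) < p / s * Real.exp (s * L x) + (1 - p / s) := by
    intro x hx
    have h := strictConvexOn_exp.2 (Set.mem_univ (s * L x)) (Set.mem_univ 0)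
      (mul_ne_zero hs.ne' hx) hθ0 hθ1 (by ring)
    simp only [smul_eq_mul, mul_zero, add_zero, Real.exp_zero, mul_one] at h
    rwa [show p / s * (s * L x) = p * L x by field_simp] at h
  have hi : Integrable (fun x => p / s * Real.exp (s * L x) + (1 - p / s)) ν :=
    (hint.const_mul _).add (integrable_const _)
  have hpos : 0 < ∫ x, (p / s * Real.exp (s * L x) + (1 - p / s) - Real.exp (p * L x)) ∂ν := by
    refine integral_pos_of_measure_support_pos (hi.sub hintp) (fun x => ?_) hne
      fun x hx => (sub_pos.2 (hlt x hx)).ne'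
    by_cases hx : L x = 0
    · simp [hx]
    · exact (sub_pos.2 (hlt x hx)).le
  rw [integral_sub hi hintp, integral_add (hint.const_mul _) (integrable_const _),
    integral_const_mul] at hpos
  rw [mgf] at h1 ⊢
  simp only [h1, integral_const, probReal_univ, smul_eq_mul, mul_one] at hpos
  linarith

/-- Markov: `m(s) ≥ exp s * ν {L ≥ 1}`, which grows without bound. -/
lemma exists_one_le_mgf (hint : ∀ s, 0 ≤ s → Integrable (fun x => Real.exp (s * L x)) ν)
    (hone : 0 < ν {x | 1 ≤ L x}) (s₀ : ℝ) :
    ∃ s, 0 ≤ s ∧ s₀ ≤ s ∧ 1 ≤ mgf L ν s := by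
  set q := ν.real {x | 1 ≤ L x} with hq
  have hq0 : 0 < q := ENNReal.toReal_pos hone.ne' (measure_ne_top _ _)
  obtain ⟨s, hs⟩ : ∃ s : ℝ, 0 ≤ s ∧ s₀ ≤ s ∧ 1 / q ≤ Real.exp s := by
    have := (Real.tendsto_exp_atTop.eventually_ge_atTop (1 / q)).and
      ((eventually_ge_atTop 0).and (eventually_ge_atTop s₀))
    obtain ⟨s, h1, h2, h3⟩ := this.exists
    exact ⟨s, h2, h3, h1⟩
  refine ⟨s, hs.1, hs.2.1, ?_⟩
  have hmarkov := mul_meas_ge_le_integral_of_nonneg (μ := ν)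
    (f := fun x => Real.exp (s * L x)) (ae_of_all _ fun x => (Real.exp_pos _).le)
    (hint s hs.1) (Real.exp s)
  have hsub : q ≤ ν.real {x | Real.exp s ≤ Real.exp (s * L x)} := by
    refine measureReal_mono fun x hx => ?_
    simp only [Set.mem_ofPred_eq, Real.exp_le_exp] at hx ⊢
    nlinarith [hs.1]
  calc (1 : ℝ) = 1 / q * q := by field_simp
    _ ≤ Real.exp s * ν.real {x | Real.exp s ≤ Real.exp (s * L x)} := by gcongr; exact hs.2.2
    _ ≤ _ := hmarkov

/-- The slope of `m` at `0` is `𝔼 L < 0`, so `m` is below `1` just after `0`; it exceeds or equals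
`1` later, and the intermediate value theorem applies. The bound `-1/2` only serves to make `0`
interior to the domain. -/
lemma exists_mgf_eq_one (hsub : Set.Ioi (-(1 / 2) : ℝ) ⊆ integrableExpSet L ν)
    (hone : 0 < ν {x | 1 ≤ L x}) (hneg : ∫ x, L x ∂ν < 0) :
    ∃ s, 0 < s ∧ mgf L ν s = 1 := by
  have hint : Set.Ioi (-(1 / 2) : ℝ) ⊆ interior (integrableExpSet L ν) :=
    interior_maximal hsub isOpen_Ioi
  have h0 := hasDerivAt_mgf (hint (by norm_num : (0 : ℝ) ∈ Set.Ioi (-(1 / 2) : ℝ)))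
  simp only [zero_mul, Real.exp_zero, mul_one] at h0
  have hsl := (hasDerivAt_iff_tendsto_slope.1 h0).mono_left
    (nhdsWithin_mono 0 (fun x (hx : x ∈ Set.Ioi (0 : ℝ)) => ne_of_gt hx))
  obtain ⟨s₁, hs₁, hpos⟩ := ((hsl.eventually (gt_mem_nhds hneg)).and self_mem_nhdsWithin).exists
  have hpos : 0 < s₁ := hpos
  have hlt : mgf L ν s₁ < 1 := by
    rw [slope_def_field, mgf_zero, sub_zero, div_neg_iff] at hs₁
    rcases hs₁ with h | h
    · linarith
    · linarith
  obtain ⟨s₂, _, h12, h2⟩ := exists_one_le_mgf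
    (fun s hs => hsub (by rw [Set.mem_Ioi]; linarith)) hone s₁
  have hc : ContinuousOn (mgf L ν) (Set.Icc s₁ s₂) :=
    continuousOn_mgf.mono fun x hx => hint (by rw [Set.mem_Ioi]; linarith [hx.1])
  obtain ⟨s, hs, h⟩ := intermediate_value_Icc h12 hc ⟨hlt.le, h2⟩
  exact ⟨s, hpos.trans_le hs.1, h⟩

end Exponents

/-- Supplies a negative moment of the growth factor; any exponent in `(-1, 0)` would serve. -/
lemma integrable_abs_rpow_gaussianReal :
    Integrable (fun x : ℝ => |x| ^ (-(1 / 2) : ℝ)) (gaussianReal 0 1) := by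
  rw [gaussianReal_of_var_ne_zero _ one_ne_zero,
    integrable_withDensity_iff (by fun_prop) (ae_of_all _ fun x => by simp [gaussianPDF])]
  have hI : IntegrableOn (fun x : ℝ => |x| ^ (-(1 / 2) : ℝ) * (gaussianPDF 0 1 x).toReal)
      (Set.Ioi 0) := by
    have h := (integrableOn_rpow_mul_exp_neg_mul_sq (b := 1 / 2) (by norm_num)
      (s := -(1 / 2)) (by norm_num)).const_mul (√(2 * Real.pi))⁻¹
    refine IntegrableOn.congr_fun h (fun x hx => ?_) measurableSet_Ioi
    have hx : 0 < x := hx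
    simp only [toReal_gaussianPDF, gaussianPDFReal, NNReal.coe_one, mul_one, sub_zero,
      abs_of_pos hx]
    rw [show -x ^ 2 / 2 = -(1 / 2) * x ^ 2 by ring]
    ring
  have hI' : IntegrableOn (fun x : ℝ => |x| ^ (-(1 / 2) : ℝ) * (gaussianPDF 0 1 x).toReal)
      (Set.Iic 0) := by
    rw [← (Measure.measurePreserving_neg (volume : Measure ℝ)).integrableOn_comp_preimage
      (Homeomorph.neg ℝ).measurableEmbedding, Set.neg_preimage, Set.neg_Iic, neg_zero,
      integrableOn_Ici_iff_integrableOn_Ioi]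
    refine IntegrableOn.congr_fun hI (fun x _ => ?_) measurableSet_Ioi
    simp [toReal_gaussianPDF, gaussianPDFReal]
  rw [← integrableOn_univ, ← Set.Iic_union_Ioi (a := (0 : ℝ))]
  exact hI'.union hI

variable {d : ℕ}

lemma measurePreserving_apply_stdGaussian (i : Fin d) :
    MeasurePreserving (fun z : EuclideanSpace ℝ (Fin d) => z i) (stdGaussian _)
      (gaussianReal 0 1) := by
  refine ⟨by fun_prop, ?_⟩
  rw [← map_pi_eq_stdGaussian, Measure.map_map (by fun_prop) (by fun_prop)]
  exact (measurePreserving_eval (fun _ : Fin d => gaussianReal 0 1) i).map_eq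

/-- The growth factor `‖φ_a(σ z)‖` of the norm in one layer. -/
noncomputable def growth (a σ : ℝ) (z : EuclideanSpace ℝ (Fin d)) : ℝ := ‖actVec a (σ • z)‖

lemma growth_nonneg (a σ : ℝ) (z : EuclideanSpace ℝ (Fin d)) : 0 ≤ growth a σ z := norm_nonneg _

lemma measurable_growth (a σ : ℝ) : Measurable (growth a σ : EuclideanSpace ℝ (Fin d) → ℝ) := by
  have := measurable_actVec (d := d) a
  unfold growth
  fun_prop

lemma growth_eq (a : ℝ) {σ : ℝ} (hσ : 0 ≤ σ) (z : EuclideanSpace ℝ (Fin d)) :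
    growth a σ z = σ * ‖actVec a z‖ := by
  rw [growth, actVec_smul_of_nonneg a hσ, norm_smul, Real.norm_of_nonneg hσ]

/-- For `a > 0`, comparison with one coordinate reduces positivity and the negative moment of the
growth factor to one-dimensional Gaussian facts. -/
lemma mul_abs_apply_le_growth {a σ : ℝ} (ha : 0 ≤ a) (ha1 : a ≤ 1) (hσ : 0 ≤ σ)
    (z : EuclideanSpace ℝ (Fin d)) (i : Fin d) : a * σ * |z i| ≤ growth a σ z := by
  rw [growth_eq a hσ, mul_comm a, mul_assoc]
  have h1 : |z i| ≤ ‖z‖ := by simpa using PiLp.norm_apply_le z i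
  have h2 := mul_norm_le_norm_actVec ha ha1 z
  gcongr
  exact (mul_le_mul_of_nonneg_left h1 ha).trans h2

lemma ae_growth_pos (hd : 0 < d) {a σ : ℝ} (ha : 0 < a) (ha1 : a ≤ 1) (hσ : 0 < σ) :
    ∀ᵐ z ∂(stdGaussian (EuclideanSpace ℝ (Fin d))), 0 < growth a σ z := by
  have h0 : ∀ᵐ x ∂(gaussianReal 0 1), x ≠ 0 := by
    have := nullSingletonClass_gaussianReal (μ := 0) (v := 1) one_ne_zero
    rw [ae_iff]; simp
  have h := (measurePreserving_apply_stdGaussian (⟨0, hd⟩ : Fin d)).quasiMeasurePreserving.ae h0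
  filter_upwards [h] with z hz
  refine lt_of_lt_of_le ?_ (mul_abs_apply_le_growth ha.le ha1 hσ.le z ⟨0, hd⟩)
  have := abs_pos.2 hz
  positivity

lemma exp_mul_log_growth_ae_eq (hd : 0 < d) {a σ : ℝ} (ha : 0 < a) (ha1 : a ≤ 1) (hσ : 0 < σ)
    (t : ℝ) : (fun z => Real.exp (t * Real.log (growth a σ z)))
      =ᵐ[stdGaussian (EuclideanSpace ℝ (Fin d))] fun z => growth a σ z ^ t := by
  filter_upwards [ae_growth_pos hd ha ha1 hσ] with z hz
  rw [Real.rpow_def_of_pos hz, mul_comm]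

lemma integrable_exp_mul_log_growth_of_nonneg (hd : 0 < d) {a σ : ℝ} (ha : 0 < a) (ha1 : a ≤ 1)
    (hσ : 0 < σ) {t : ℝ} (ht : 0 ≤ t) :
    Integrable (fun z => Real.exp (t * Real.log (growth a σ z)))
      (stdGaussian (EuclideanSpace ℝ (Fin d))) := by
  rcases ht.eq_or_lt with rfl | ht
  · simp
  · rw [integrable_congr (exp_mul_log_growth_ae_eq hd ha ha1 hσ t)]
    simp only [growth_eq a hσ.le, Real.mul_rpow hσ.le (norm_nonneg _)]
    exact (integrable_norm_actVec_rpow ha.le ha1 ht).const_mul _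

lemma integrable_exp_neg_half_mul_log_growth (hd : 0 < d) {a σ : ℝ} (ha : 0 < a) (ha1 : a ≤ 1)
    (hσ : 0 < σ) : Integrable (fun z => Real.exp (-(1 / 2) * Real.log (growth a σ z)))
      (stdGaussian (EuclideanSpace ℝ (Fin d))) := by
  have hm := measurable_growth (d := d) a σ
  have hi := ((measurePreserving_apply_stdGaussian (⟨0, hd⟩ : Fin d)).integrable_comp_of_integrable
    integrable_abs_rpow_gaussianReal).const_mul ((a * σ) ^ (-(1 / 2) : ℝ))
  have h0 : ∀ᵐ x ∂(gaussianReal 0 1), x ≠ 0 := by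
    have := nullSingletonClass_gaussianReal (μ := 0) (v := 1) one_ne_zero
    rw [ae_iff]; simp
  have h := (measurePreserving_apply_stdGaussian (⟨0, hd⟩ : Fin d)).quasiMeasurePreserving.ae h0
  refine hi.mono' (hm.log.const_mul _).exp.aestronglyMeasurable ?_
  filter_upwards [exp_mul_log_growth_ae_eq hd ha ha1 hσ (-(1 / 2)), h] with z hz hz0
  have hz0 : 0 < |z ⟨0, hd⟩| := abs_pos.2 hz0
  rw [hz, Real.norm_of_nonneg (Real.rpow_nonneg (growth_nonneg a σ z) _), Function.comp_apply,
    ← Real.mul_rpow (by positivity) (by positivity)]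
  exact Real.rpow_le_rpow_of_nonpos (by positivity)
    (mul_abs_apply_le_growth ha.le ha1 hσ.le z _) (by norm_num)

lemma Ioi_subset_integrableExpSet_log_growth (hd : 0 < d) {a σ : ℝ} (ha : 0 < a) (ha1 : a ≤ 1)
    (hσ : 0 < σ) : Set.Ioi (-(1 / 2) : ℝ) ⊆ integrableExpSet (fun z => Real.log (growth a σ z))
      (stdGaussian (EuclideanSpace ℝ (Fin d))) := by
  intro t ht
  rcases le_or_gt 0 t with h | h
  · exact integrable_exp_mul_log_growth_of_nonneg hd ha ha1 hσ h
  · exact integrable_exp_mul_of_le_of_le (integrable_exp_neg_half_mul_log_growth hd ha ha1 hσ)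
      (integrable_exp_mul_log_growth_of_nonneg hd ha ha1 hσ le_rfl) (le_of_lt ht) h.le

lemma integrable_log_growth (hd : 0 < d) {a σ : ℝ} (ha : 0 < a) (ha1 : a ≤ 1) (hσ : 0 < σ) :
    Integrable (fun z => Real.log (growth a σ z)) (stdGaussian (EuclideanSpace ℝ (Fin d))) :=
  integrable_of_mem_interior_integrableExpSet
    (interior_maximal (Ioi_subset_integrableExpSet_log_growth hd ha ha1 hσ) isOpen_Ioi
      (by norm_num : (0 : ℝ) ∈ Set.Ioi (-(1 / 2) : ℝ)))

/-- One large positive coordinate passes unchanged through the activation and suffices. This gives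
both the non-degeneracy behind the strict inequalities and the return of `m` to `1`. -/
lemma measure_one_le_log_growth_pos (hd : 0 < d) {a σ : ℝ} (hσ : 0 < σ) :
    0 < stdGaussian (EuclideanSpace ℝ (Fin d)) {z | 1 ≤ Real.log (growth a σ z)} := by
  have hpos : 0 < gaussianReal 0 1 (Set.Ioi (Real.exp 1 / σ)) := by
    rw [pos_iff_ne_zero]
    intro h
    have := gaussianReal_absolutelyContinuous' 0 one_ne_zero h
    simp at this
  rw [← (measurePreserving_apply_stdGaussian (⟨0, hd⟩ : Fin d)).measure_preimage
    measurableSet_Ioi.nullMeasurableSet] at hpos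
  refine hpos.trans_le (measure_mono fun z hz => ?_)
  have hz : Real.exp 1 / σ < z ⟨0, hd⟩ := hz
  have hz0 : 0 < z ⟨0, hd⟩ := (by positivity : 0 < Real.exp 1 / σ).trans hz
  rw [div_lt_iff₀ hσ] at hz
  have h1 : z ⟨0, hd⟩ ≤ ‖actVec a z‖ := by
    have := PiLp.norm_apply_le (actVec a z) ⟨0, hd⟩
    simpa [actVec, act_of_pos a hz0, abs_of_pos hz0] using this
  have h2 : Real.exp 1 ≤ growth a σ z := by
    rw [growth_eq a hσ.le]; nlinarith
  rw [Set.mem_ofPred_eq, Real.le_log_iff_exp_le ((Real.exp_pos 1).trans_le h2)]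
  exact h2

lemma measure_log_growth_ne_zero_pos (hd : 0 < d) {a σ : ℝ} (hσ : 0 < σ) :
    0 < stdGaussian (EuclideanSpace ℝ (Fin d)) {z | Real.log (growth a σ z) ≠ 0} :=
  (measure_one_le_log_growth_pos hd hσ).trans_le
    (measure_mono fun _ hz => (one_pos.trans_le hz).ne')

lemma mgf_log_growth (hd : 0 < d) {a σ : ℝ} (ha : 0 < a) (ha1 : a ≤ 1) (hσ : 0 < σ) {s : ℝ}
    (hs : 0 < s) :
    mgf (fun z => Real.log (growth a σ z)) (stdGaussian (EuclideanSpace ℝ (Fin d))) s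
      = σ ^ s * momentConst a s d := by
  rw [mgf, integral_congr_ae (exp_mul_log_growth_ae_eq hd ha ha1 hσ s),
    momentConst_eq_integral ha ha1 hs]
  simp only [growth_eq a hσ.le, Real.mul_rpow hσ.le (norm_nonneg _)]
  rw [integral_const_mul]

/-- `σ` is the critical standard deviation of order `s` iff `𝔼 ‖φ_a(σ z)‖ˢ = 1`. -/
lemma eq_critSigma_iff (hd : 0 < d) {a σ : ℝ} (ha : 0 < a) (ha1 : a ≤ 1) (hσ : 0 < σ) {s : ℝ}
    (hs : 0 < s) : σ = critSigma a s d ↔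
      mgf (fun z => Real.log (growth a σ z)) (stdGaussian (EuclideanSpace ℝ (Fin d))) s = 1 := by
  have h := mgf_pos (integrable_exp_mul_log_growth_of_nonneg hd ha ha1 hσ hs.le)
  rw [mgf_log_growth hd ha ha1 hσ hs] at h ⊢
  have hσs : 0 < σ ^ s := by positivity
  have hI : 0 < momentConst a s d := (pos_iff_pos_of_mul_pos h).1 hσs
  have hI' : 0 < momentConst a s d ^ (1 / s) := by positivity
  have h2 : (momentConst a s d ^ (1 / s)) ^ s = momentConst a s d := by
    rw [← Real.rpow_mul hI.le, one_div_mul_cancel hs.ne', Real.rpow_one]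
  rw [critSigma, eq_div_iff hI'.ne', ← Real.rpow_left_inj (z := s) (by positivity) one_pos.le hs.ne',
    Real.mul_rpow hσ.le hI'.le, h2, Real.one_rpow]

lemma lyapunov_eq (a σ : ℝ) : lyapunov a σ d
    = ∫ z, Real.log (growth a σ z) ∂(stdGaussian (EuclideanSpace ℝ (Fin d))) := rfl

lemma lyapunov_neg_iff (hd : 0 < d) {a σ : ℝ} (ha : 0 < a) (ha1 : a ≤ 1) (hσ : 0 < σ) :
    lyapunov a σ d < 0 ↔ ∃ s : ℝ, 0 < s ∧ σ = critSigma a s d := by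
  rw [lyapunov_eq]
  constructor
  · intro h
    obtain ⟨s, hs, h1⟩ := exists_mgf_eq_one (Ioi_subset_integrableExpSet_log_growth hd ha ha1 hσ)
      (measure_one_le_log_growth_pos hd hσ) h
    exact ⟨s, hs, (eq_critSigma_iff hd ha ha1 hσ hs).2 h1⟩
  · rintro ⟨s, hs, h⟩
    exact integral_neg_of_mgf_eq_one (integrable_log_growth hd ha ha1 hσ) hs
      (integrable_exp_mul_log_growth_of_nonneg hd ha ha1 hσ hs.le)
      (measure_log_growth_ne_zero_pos hd hσ) ((eq_critSigma_iff hd ha ha1 hσ hs).1 h)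

/-- The `p`-th moment of the growth factor, as a lower Lebesgue integral. -/
lemma lintegral_enorm_growth_rpow (hd : 0 < d) {a σ : ℝ} (ha : 0 < a) (ha1 : a ≤ 1) (hσ : 0 < σ)
    {p : ℝ} (hp : 0 < p) :
    ∫⁻ z, ‖growth a σ z‖ₑ ^ p ∂(stdGaussian (EuclideanSpace ℝ (Fin d)))
      = ENNReal.ofReal (mgf (fun z => Real.log (growth a σ z))
        (stdGaussian (EuclideanSpace ℝ (Fin d))) p) := by
  have hi := integrable_exp_mul_log_growth_of_nonneg hd ha ha1 hσ hp.le
  rw [mgf, ofReal_integral_eq_lintegral_ofReal hi (ae_of_all _ fun z => (Real.exp_pos _).le)]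
  refine lintegral_congr_ae ?_
  filter_upwards [exp_mul_log_growth_ae_eq hd ha ha1 hσ p] with z hz
  rw [hz, ← ENNReal.ofReal_rpow_of_nonneg (growth_nonneg a σ z) hp.le,
    Real.enorm_of_nonneg (growth_nonneg a σ z)]

/-- ReLU annihilates the closed negative orthant, a box of positive product measure. -/
lemma measure_growth_zero_pos {σ : ℝ} (hσ : 0 < σ) :
    0 < stdGaussian (EuclideanSpace ℝ (Fin d)) {z | growth 0 σ z = 0} := by
  have hpos : 0 < gaussianReal 0 1 (Set.Iic 0) := by
    rw [pos_iff_ne_zero]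
    intro h
    have := gaussianReal_absolutelyContinuous' 0 one_ne_zero h
    simp at this
  have hm : MeasurableSet {z : EuclideanSpace ℝ (Fin d) | growth 0 σ z = 0} :=
    measurable_growth 0 σ (measurableSet_singleton 0)
  rw [← map_pi_eq_stdGaussian, Measure.map_apply (by fun_prop) hm]
  have hbox : 0 < Measure.pi (fun _ : Fin d => gaussianReal 0 1)
      (Set.univ.pi fun _ => Set.Iic 0) := by
    rw [Measure.pi_pi, pos_iff_ne_zero, Finset.prod_ne_zero_iff]
    exact fun _ _ => hpos.ne'
  refine hbox.trans_le (measure_mono fun x hx => ?_)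
  have : actVec 0 (WithLp.toLp 2 x) = 0 := by
    ext i
    have : x i ≤ 0 := hx i (Set.mem_univ i)
    simp [actVec, act_of_nonpos 0 this]
  simp [growth_eq 0 hσ.le, this]

end ReLUNet

/-! ### Gaussian layers as independent, identically distributed growth factors. -/

namespace ReLUNet

variable {d : ℕ}

/-- Matrix-vector product, with the matrix given by its family of entries. -/
noncomputable def mulEntries (M : Fin d × Fin d → ℝ) (x : EuclideanSpace ℝ (Fin d)) :
    EuclideanSpace ℝ (Fin d) :=
  WithLp.toLp 2 fun i => ∑ j, M (i, j) * x j

lemma measurable_uncurry_mulEntries : Measurable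
    fun p : (Fin d × Fin d → ℝ) × EuclideanSpace ℝ (Fin d) => mulEntries p.1 p.2 := by
  unfold mulEntries
  fun_prop

lemma mulEntries_smul (M : Fin d × Fin d → ℝ) (c : ℝ) (x : EuclideanSpace ℝ (Fin d)) :
    mulEntries M (c • x) = c • mulEntries M x := by
  ext i
  simp only [mulEntries, PiLp.smul_apply, smul_eq_mul, Finset.mul_sum]
  exact Finset.sum_congr rfl fun j _ => by ring

/-- A Gaussian matrix maps a unit vector to a Gaussian vector. -/
lemma map_mulEntries_pi_gaussianReal (σ : ℝ) {u : EuclideanSpace ℝ (Fin d)}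
    (hu : ‖u‖ = 1) :
    (Measure.pi fun _ : Fin d × Fin d => gaussianReal 0 (σ ^ 2).toNNReal).map
        (fun M => mulEntries M u)
      = (stdGaussian (EuclideanSpace ℝ (Fin d))).map (fun z => σ • z) := by
  have hm : Measurable fun M : Fin d × Fin d → ℝ => mulEntries M u :=
    measurable_uncurry_mulEntries.comp (measurable_id.prodMk measurable_const)
  have := Measure.isProbabilityMeasure_map (μ := Measure.pi fun _ : Fin d × Fin d =>
    gaussianReal 0 (σ ^ 2).toNNReal) hm.aemeasurable
  have := Measure.isProbabilityMeasure_map (μ := stdGaussian (EuclideanSpace ℝ (Fin d)))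
    (f := fun z => σ • z) (by fun_prop)
  refine Measure.ext_of_charFun (funext fun t => ?_)
  rw [charFun_map_smul, charFun_stdGaussian]
  -- Since `⟨M u, t⟩ = ⟨M, t ⊗ u⟩`, the characteristic function is that of the entries at `t ⊗ u`,
  -- whose norm is `‖t‖` because `‖u‖ = 1`.
  have h1 : charFun ((Measure.pi fun _ : Fin d × Fin d => gaussianReal 0 (σ ^ 2).toNNReal).map
        (fun M => mulEntries M u)) t
      = charFun ((Measure.pi fun _ : Fin d × Fin d => gaussianReal 0 (σ ^ 2).toNNReal).map
        (WithLp.toLp 2)) (WithLp.toLp 2 fun q : Fin d × Fin d => t q.1 * u q.2) := by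
    rw [charFun_apply, charFun_apply, integral_map hm.aemeasurable (by fun_prop),
      integral_map (by fun_prop) (by fun_prop)]
    congr 1; funext M
    have : inner ℝ (mulEntries M u) t = inner ℝ (WithLp.toLp 2 M)
        (WithLp.toLp 2 fun q : Fin d × Fin d => t q.1 * u q.2) := by
      simp only [mulEntries, PiLp.inner_apply, Fintype.sum_prod_type]
      refine Finset.sum_congr rfl fun i _ => ?_
      simp only [RCLike.inner_apply, conj_trivial, Finset.mul_sum]
      exact Finset.sum_congr rfl fun j _ => by ring
    rw [this]
  have h2 : ∑ q : Fin d × Fin d, (t q.1 * u q.2) ^ 2 = ‖t‖ ^ 2 := by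
    have : ∑ j, u j ^ 2 = 1 := by
      have := EuclideanSpace.norm_sq_eq u
      simpa [hu] using this.symm
    simp only [mul_pow, Fintype.sum_prod_type, ← Finset.mul_sum, this, mul_one]
    simp [EuclideanSpace.norm_sq_eq]
  rw [h1, charFun_pi]
  simp only [charFun_gaussianReal]
  rw [← Complex.exp_sum]
  congr 1
  have h3 : ∀ q : Fin d × Fin d, (((t q.1 * u q.2 : ℝ) : ℂ) * ((0 : ℝ) : ℂ) * Complex.I
      - (((σ ^ 2).toNNReal : ℝ) : ℂ) * ((t q.1 * u q.2 : ℝ) : ℂ) ^ 2 / 2)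
      = ((-(σ ^ 2 / 2) * (t q.1 * u q.2) ^ 2 : ℝ) : ℂ) := by
    intro q
    rw [Real.coe_toNNReal _ (sq_nonneg σ)]
    push_cast; ring
  have h4 : ((‖σ‖ : ℝ) : ℂ) ^ 2 = (σ : ℂ) ^ 2 := by
    rw [← Complex.ofReal_pow, Real.norm_eq_abs, sq_abs, Complex.ofReal_pow]
  rw [Finset.sum_congr rfl fun q _ => h3 q, ← Complex.ofReal_sum, ← Finset.mul_sum, h2, norm_smul]
  push_cast
  rw [mul_pow, h4]
  ring

/-- The law of all the weights, as a product measure. -/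
noncomputable def weightLaw (d : ℕ) (σ : ℝ) : Measure (ℕ × Fin d × Fin d → ℝ) :=
  Measure.infinitePi fun _ => gaussianReal 0 (σ ^ 2).toNNReal

instance (σ : ℝ) : IsProbabilityMeasure (weightLaw d σ) := by
  unfold weightLaw; infer_instance

/-- The weights of a single layer. -/
def layerWeights (k : ℕ) (h : ℕ × Fin d × Fin d → ℝ) : Fin d × Fin d → ℝ := fun q => h (k, q)

lemma measurable_layerWeights (k : ℕ) : Measurable (layerWeights k : (ℕ × Fin d × Fin d → ℝ) → _) := by
  unfold layerWeights; fun_prop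

lemma map_layerWeights (σ : ℝ) (k : ℕ) : (weightLaw d σ).map (layerWeights k)
    = Measure.pi fun _ : Fin d × Fin d => gaussianReal 0 (σ ^ 2).toNNReal := by
  have h1 : iIndepFun (fun (q : ℕ × Fin d × Fin d) (h : ℕ × Fin d × Fin d → ℝ) => h q)
      (weightLaw d σ) := iIndepFun_infinitePi (X := fun _ x => x) fun _ => measurable_id
  have h2 := h1.precomp (g := fun q : Fin d × Fin d => (k, q)) (fun x y hxy => by simpa using hxy)
  have h3 := (iIndepFun_iff_map_fun_eq_pi_map (fun q => (measurable_pi_apply _).aemeasurable)).1 h2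
  refine h3.trans ?_
  congr 1; funext q
  exact Measure.infinitePi_map_eval _ _

/-- A function of the weights of the first `k` layers is independent of the next layer. -/
lemma indepFun_layerWeights {β : Type*} [MeasurableSpace β] (σ : ℝ) (k : ℕ)
    {X : (ℕ × Fin d × Fin d → ℝ) → β} (hX : Measurable X)
    (hdep : ∀ h h' : ℕ × Fin d × Fin d → ℝ, (∀ q, q.1 < k → h q = h' q) → X h = X h') :
    IndepFun X (layerWeights k) (weightLaw d σ) := by
  have h1 : iIndepFun (fun (q : ℕ × Fin d × Fin d) (h : ℕ × Fin d × Fin d → ℝ) => h q)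
      (weightLaw d σ) := iIndepFun_infinitePi (X := fun _ x => x) fun _ => measurable_id
  set S : Finset (ℕ × Fin d × Fin d) := Finset.range k ×ˢ Finset.univ with hS
  set T : Finset (ℕ × Fin d × Fin d) := {k} ×ˢ Finset.univ with hT
  have hST : Disjoint S T := by
    rw [Finset.disjoint_left]
    intro q hq hq'
    simp only [hS, hT, Finset.mem_product, Finset.mem_range, Finset.mem_singleton] at hq hq'
    omega
  have h2 := h1.indepFun_finset S T hST (fun q => by fun_prop)
  have hmemT : ∀ q : Fin d × Fin d, (k, q) ∈ T := fun q => by simp [hT]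
  -- By `hdep`, `X` is unchanged when all weights outside `S` are set to zero, so it factors through
  -- the coordinates in `S`.
  let ext : (S → ℝ) → ℕ × Fin d × Fin d → ℝ := fun g q => if hq : q ∈ S then g ⟨q, hq⟩ else 0
  have hext : Measurable ext := by
    refine measurable_pi_lambda _ fun q => ?_
    by_cases hq : q ∈ S
    · simp only [ext, hq, dite_true]; fun_prop
    · simp only [ext, hq, dite_false]; fun_prop
  have h3 := h2.comp (φ := X ∘ ext) (ψ := fun (g : T → ℝ) (q : Fin d × Fin d) => g ⟨(k, q), hmemT q⟩)
    (hX.comp hext) (by fun_prop)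
  refine h3.congr (ae_of_all _ fun h => ?_) (ae_of_all _ fun h => rfl)
  refine hdep _ _ fun q hq => ?_
  have : q ∈ S := by simp [hS, hq]
  simp [ext, this]

/-- If `X` and `M` are independent and `f x M` has the law `ρ` for every `x`, then `f X M` has the
law `ρ` and is independent of every function of `X`. -/
lemma indepFun_and_map_eq_of_forall_map_eq {Ω β γ δ : Type*} {mΩ : MeasurableSpace Ω}
    {mβ : MeasurableSpace β} {mγ : MeasurableSpace γ} {mδ : MeasurableSpace δ}
    {P : Measure Ω} [IsProbabilityMeasure P] {X : Ω → β} {M : Ω → γ} (hX : Measurable X)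
    (hM : Measurable M) (hXM : IndepFun X M P) {f : β → γ → δ}
    (hf : Measurable (Function.uncurry f)) {ρ : Measure δ} [IsProbabilityMeasure ρ]
    (hρ : ∀ x, (P.map M).map (f x) = ρ) :
    IndepFun X (fun ω => f (X ω) (M ω)) P ∧ P.map (fun ω => f (X ω) (M ω)) = ρ := by
  have hfXM : Measurable fun ω => f (X ω) (M ω) := hf.comp (hX.prodMk hM)
  have := Measure.isProbabilityMeasure_map (μ := P) hX.aemeasurable
  have := Measure.isProbabilityMeasure_map (μ := P) hM.aemeasurable
  have h1 := (indepFun_iff_map_prod_eq_prod_map_map hX.aemeasurable hM.aemeasurable).1 hXM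
  -- The map `(x, m) ↦ (x, f x m)` carries the product law to `(P.map X).prod ρ`, because every
  -- fibre has image law `ρ`.
  have h2 := (MeasurePreserving.id (P.map X)).skew_product hf (ae_of_all _ hρ)
  have h3 : P.map (fun ω => (X ω, f (X ω) (M ω))) = (P.map X).prod ρ := by
    rw [← h2.map_eq, ← h1, Measure.map_map h2.measurable (hX.prodMk hM)]
    rfl
  have h4 : P.map (fun ω => f (X ω) (M ω)) = ρ := by
    have : P.map (fun ω => f (X ω) (M ω)) = (P.map (fun ω => (X ω, f (X ω) (M ω)))).snd := by
      rw [Measure.snd_map_prodMk hX]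
    rw [this, h3, Measure.snd_prod]
  refine ⟨(indepFun_iff_map_prod_eq_prod_map_map hX.aemeasurable hfXM.aemeasurable).2 ?_, h4⟩
  rw [h3, h4]

/-- The layer outputs as functions of the family of all the weights. -/
noncomputable def orbit (a : ℝ) (x0 : EuclideanSpace ℝ (Fin d)) :
    ℕ → (ℕ × Fin d × Fin d → ℝ) → EuclideanSpace ℝ (Fin d)
  | 0, _ => x0
  | k + 1, h => actVec a (mulEntries (layerWeights k h) (orbit a x0 k h))

lemma output_eq_orbit {Ω : Type*} (a : ℝ) (W : ℕ → Ω → Matrix (Fin d) (Fin d) ℝ)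
    {b : ℕ → EuclideanSpace ℝ (Fin d)} (hb : ∀ k, b k = 0) (x0 : EuclideanSpace ℝ (Fin d))
    (k : ℕ) (ω : Ω) : output a W b x0 k ω = orbit a x0 k fun q => W q.1 ω q.2.1 q.2.2 := by
  induction k with
  | zero => rfl
  | succ k ih => simp [output, orbit, layer, ih, hb, mulEntries, layerWeights]

lemma measurable_orbit (a : ℝ) (x0 : EuclideanSpace ℝ (Fin d)) (k : ℕ) :
    Measurable (orbit a x0 k) := by
  induction k with
  | zero => exact measurable_const
  | succ k ih =>
    exact (measurable_actVec a).comp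
      (measurable_uncurry_mulEntries.comp ((measurable_layerWeights k).prodMk ih))

lemma layerWeights_congr {k j : ℕ} (hjk : j < k) {h h' : ℕ × Fin d × Fin d → ℝ}
    (hh : ∀ q, q.1 < k → h q = h' q) : layerWeights j h = layerWeights j h' :=
  funext fun _ => hh _ hjk

lemma orbit_congr (a : ℝ) (x0 : EuclideanSpace ℝ (Fin d)) {k j : ℕ} (hjk : j ≤ k)
    {h h' : ℕ × Fin d × Fin d → ℝ} (hh : ∀ q, q.1 < k → h q = h' q) :
    orbit a x0 j h = orbit a x0 j h' := by
  induction j with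
  | zero => rfl
  | succ j ih => rw [orbit, orbit, ih (by omega), layerWeights_congr hjk hh]

/-- The direction of `x`, and that of `x0` in place of `x = 0`. -/
noncomputable def direction (x0 x : EuclideanSpace ℝ (Fin d)) : EuclideanSpace ℝ (Fin d) :=
  open Classical in if x = 0 then ‖x0‖⁻¹ • x0 else ‖x‖⁻¹ • x

lemma measurable_direction (x0 : EuclideanSpace ℝ (Fin d)) : Measurable (direction x0) := by
  unfold direction
  exact Measurable.ite (measurableSet_singleton 0) measurable_const (by fun_prop)

/-- The fallback direction at `x = 0` matters for ReLU, where outputs do vanish: the growth factor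
then has the same law for every input, without exception. -/
lemma norm_direction {x0 : EuclideanSpace ℝ (Fin d)} (hx0 : x0 ≠ 0)
    (x : EuclideanSpace ℝ (Fin d)) : ‖direction x0 x‖ = 1 := by
  unfold direction
  split_ifs with h
  · exact norm_smul_inv_norm (𝕜 := ℝ) hx0
  · exact norm_smul_inv_norm (𝕜 := ℝ) h

lemma norm_smul_direction (x0 x : EuclideanSpace ℝ (Fin d)) : ‖x‖ • direction x0 x = x := by
  by_cases h : x = 0
  · simp [h]
  · rw [direction, if_neg h, smul_smul, mul_inv_cancel₀ (norm_ne_zero_iff.2 h), one_smul]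

/-- The norm of the output of a layer with input the direction of `x`. -/
@[irreducible]
noncomputable def normLayer (a : ℝ) (x0 x : EuclideanSpace ℝ (Fin d)) (M : Fin d × Fin d → ℝ) : ℝ :=
  ‖actVec a (mulEntries M (direction x0 x))‖

/-- The factor by which the norm grows in the layer `k + 1`. -/
noncomputable def factor (a : ℝ) (x0 : EuclideanSpace ℝ (Fin d)) (k : ℕ)
    (h : ℕ × Fin d × Fin d → ℝ) : ℝ :=
  normLayer a x0 (orbit a x0 k h) (layerWeights k h)

/-- Positive homogeneity pulls the norm of the input out of the layer; a zero input is covered as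
well. -/
lemma norm_orbit_succ (a : ℝ) (x0 : EuclideanSpace ℝ (Fin d)) (k : ℕ)
    (h : ℕ × Fin d × Fin d → ℝ) :
    ‖orbit a x0 (k + 1) h‖ = ‖orbit a x0 k h‖ * factor a x0 k h := by
  rw [orbit, factor, normLayer]
  conv_lhs => rw [← norm_smul_direction x0 (orbit a x0 k h)]
  rw [mulEntries_smul, actVec_smul_of_nonneg a (norm_nonneg _), norm_smul, norm_norm]

lemma measurable_normLayer (a : ℝ) (x0 : EuclideanSpace ℝ (Fin d)) :
    Measurable fun p : EuclideanSpace ℝ (Fin d) × (Fin d × Fin d → ℝ) =>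
      normLayer a x0 p.1 p.2 := by
  have h1 : Measurable fun p : EuclideanSpace ℝ (Fin d) × (Fin d × Fin d → ℝ) =>
      (p.2, direction x0 p.1) :=
    measurable_snd.prodMk ((measurable_direction x0).comp measurable_fst)
  unfold normLayer
  exact ((measurable_actVec a).comp (measurable_uncurry_mulEntries.comp h1)).norm

lemma measurable_factor (a : ℝ) (x0 : EuclideanSpace ℝ (Fin d)) (k : ℕ) :
    Measurable (factor a x0 k) := by
  have h : Measurable fun h : ℕ × Fin d × Fin d → ℝ => (orbit a x0 k h, layerWeights k h) :=
    (measurable_orbit a x0 k).prodMk (measurable_layerWeights k)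
  unfold factor
  exact (measurable_normLayer a x0).fun_comp h

lemma map_normLayer (a σ : ℝ) {x0 : EuclideanSpace ℝ (Fin d)} (hx0 : x0 ≠ 0) (k : ℕ)
    (x : EuclideanSpace ℝ (Fin d)) :
    ((weightLaw d σ).map (layerWeights k)).map (normLayer a x0 x)
      = (stdGaussian (EuclideanSpace ℝ (Fin d))).map (growth a σ) := by
  have hnm := (measurable_actVec (d := d) a).norm
  have hm : Measurable fun M : Fin d × Fin d → ℝ => mulEntries M (direction x0 x) :=
    measurable_uncurry_mulEntries.comp (measurable_id.prodMk measurable_const)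
  have h1 := congrArg (Measure.map fun y => ‖actVec a y‖)
    (map_mulEntries_pi_gaussianReal σ (norm_direction hx0 x))
  rw [Measure.map_map hnm hm, Measure.map_map hnm (by fun_prop)] at h1
  rw [map_layerWeights]
  unfold normLayer
  exact h1

lemma factor_congr (a : ℝ) (x0 : EuclideanSpace ℝ (Fin d)) {k j : ℕ} (hjk : j < k)
    {h h' : ℕ × Fin d × Fin d → ℝ} (hh : ∀ q, q.1 < k → h q = h' q) :
    factor a x0 j h = factor a x0 j h' := by
  rw [factor, factor, orbit_congr a x0 hjk.le hh, layerWeights_congr hjk hh]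

/-- The growth factor of a layer is independent of the previous layers, and its law is that of
`‖φ_a(σ z)‖`. -/
lemma indepFun_factor_and_map_factor {β : Type*} [MeasurableSpace β] (a σ : ℝ)
    {x0 : EuclideanSpace ℝ (Fin d)} (hx0 : x0 ≠ 0) (k : ℕ)
    {X : (ℕ × Fin d × Fin d → ℝ) → β} (hX : Measurable X)
    (hdep : ∀ h h' : ℕ × Fin d × Fin d → ℝ, (∀ q, q.1 < k → h q = h' q) → X h = X h') :
    IndepFun X (factor a x0 k) (weightLaw d σ) ∧
      (weightLaw d σ).map (factor a x0 k)
        = (stdGaussian (EuclideanSpace ℝ (Fin d))).map (growth a σ) := by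
  -- The factor depends on the current output, so `X` is paired with it; independence from the pair
  -- then restricts to `X`.
  have hY : Measurable fun h => (X h, orbit a x0 k h) := hX.prodMk (measurable_orbit a x0 k)
  have hind := indepFun_layerWeights σ k hY fun h h' hh =>
    Prod.ext (hdep h h' hh) (orbit_congr a x0 le_rfl hh)
  have hf : Measurable (Function.uncurry fun (x : β × EuclideanSpace ℝ (Fin d)) =>
      normLayer a x0 x.2) := by
    have h1 : Measurable fun p : (β × EuclideanSpace ℝ (Fin d)) × (Fin d × Fin d → ℝ) =>
        (p.1.2, p.2) := (measurable_snd.comp measurable_fst).prodMk measurable_snd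
    unfold Function.uncurry
    exact (measurable_normLayer a x0).fun_comp h1
  have := Measure.isProbabilityMeasure_map (μ := stdGaussian (EuclideanSpace ℝ (Fin d)))
    (measurable_growth a σ).aemeasurable
  have h := indepFun_and_map_eq_of_forall_map_eq hY (measurable_layerWeights k) hind hf
    (ρ := (stdGaussian (EuclideanSpace ℝ (Fin d))).map (growth a σ))
    fun x => map_normLayer a σ hx0 k x.2
  exact ⟨h.1.comp measurable_fst measurable_id, h.2⟩

lemma map_factor (a σ : ℝ) {x0 : EuclideanSpace ℝ (Fin d)} (hx0 : x0 ≠ 0) (k : ℕ) :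
    (weightLaw d σ).map (factor a x0 k)
      = (stdGaussian (EuclideanSpace ℝ (Fin d))).map (growth a σ) :=
  (indepFun_factor_and_map_factor a σ hx0 k (measurable_orbit a x0 k)
    fun _ _ hh => orbit_congr a x0 le_rfl hh).2

lemma indepFun_orbit_factor (a σ : ℝ) {x0 : EuclideanSpace ℝ (Fin d)} (hx0 : x0 ≠ 0) (k : ℕ) :
    IndepFun (orbit a x0 k) (factor a x0 k) (weightLaw d σ) :=
  (indepFun_factor_and_map_factor a σ hx0 k (measurable_orbit a x0 k)
    fun _ _ hh => orbit_congr a x0 le_rfl hh).1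

/-- Pairwise independence is all that Etemadi's form of the strong law requires. -/
lemma pairwise_indepFun_factor (a σ : ℝ) {x0 : EuclideanSpace ℝ (Fin d)} (hx0 : x0 ≠ 0) :
    Pairwise fun i j => IndepFun (factor a x0 i) (factor a x0 j) (weightLaw d σ) := by
  have key : ∀ i j, i < j → IndepFun (factor a x0 i) (factor a x0 j) (weightLaw d σ) :=
    fun i j hij => (indepFun_factor_and_map_factor a σ hx0 j (measurable_factor a x0 i)
      fun _ _ hh => factor_congr a x0 hij hh).1
  intro i j hij
  rcases hij.lt_or_gt with h | h
  · exact key i j h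
  · exact (key j i h).symm

end ReLUNet

/-! ### Almost sure growth rate, moments, and extinction for ReLU. -/

namespace ReLUNet

variable {d : ℕ}

lemma tendsto_atTop_of_tendsto_log_div {u : ℕ → ℝ} (hu : ∀ k, 0 < u k) {μ : ℝ}
    (h : Tendsto (fun k : ℕ => Real.log (u k) / k) atTop (𝓝 μ)) (hμ : 0 < μ) :
    Tendsto u atTop atTop := by
  have h1 := Real.tendsto_exp_atTop.comp
    (h.pos_mul_atTop hμ (tendsto_natCast_atTop_atTop (R := ℝ)))
  refine h1.congr' ?_
  filter_upwards [eventually_ge_atTop 1] with k hk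
  have : (k : ℝ) ≠ 0 := by positivity
  simp [div_mul_cancel₀ _ this, Real.exp_log (hu k)]

lemma tendsto_zero_of_tendsto_log_div {u : ℕ → ℝ} (hu : ∀ k, 0 < u k) {μ : ℝ}
    (h : Tendsto (fun k : ℕ => Real.log (u k) / k) atTop (𝓝 μ)) (hμ : μ < 0) :
    Tendsto u atTop (𝓝 0) := by
  have h1 := Real.tendsto_exp_atBot.comp
    (h.neg_mul_atTop hμ (tendsto_natCast_atTop_atTop (R := ℝ)))
  refine h1.congr' ?_
  filter_upwards [eventually_ge_atTop 1] with k hk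
  have : (k : ℝ) ≠ 0 := by positivity
  simp [div_mul_cancel₀ _ this, Real.exp_log (hu k)]

lemma ae_factor_pos (hd : 0 < d) {a σ : ℝ} (ha : 0 < a) (ha1 : a ≤ 1) (hσ : 0 < σ)
    {x0 : EuclideanSpace ℝ (Fin d)} (hx0 : x0 ≠ 0) :
    ∀ᵐ h ∂(weightLaw d σ), ∀ k, 0 < factor a x0 k h := by
  rw [ae_all_iff]
  intro k
  refine ae_of_ae_map (p := fun r => 0 < r) (measurable_factor a x0 k).aemeasurable ?_
  rw [map_factor a σ hx0, ae_map_iff (measurable_growth a σ).aemeasurable measurableSet_Ioi]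
  exact ae_growth_pos hd ha ha1 hσ

lemma norm_orbit_pos {a : ℝ} {x0 : EuclideanSpace ℝ (Fin d)} (hx0 : x0 ≠ 0)
    {h : ℕ × Fin d × Fin d → ℝ} (hpos : ∀ k, 0 < factor a x0 k h) (k : ℕ) :
    0 < ‖orbit a x0 k h‖ := by
  induction k with
  | zero => exact norm_pos_iff.2 hx0
  | succ k ih => rw [norm_orbit_succ]; exact mul_pos ih (hpos k)

lemma log_norm_orbit {a : ℝ} {x0 : EuclideanSpace ℝ (Fin d)} (hx0 : x0 ≠ 0)
    {h : ℕ × Fin d × Fin d → ℝ} (hpos : ∀ k, 0 < factor a x0 k h) (k : ℕ) :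
    Real.log ‖orbit a x0 k h‖
      = Real.log ‖x0‖ + ∑ i ∈ Finset.range k, Real.log (factor a x0 i h) := by
  induction k with
  | zero => simp [orbit]
  | succ k ih =>
    rw [norm_orbit_succ, Real.log_mul (norm_orbit_pos hx0 hpos k).ne' (hpos k).ne', ih,
      Finset.sum_range_succ, add_assoc]

/-- The exponential growth rate of the layer outputs is the Lyapunov exponent. -/
lemma ae_tendsto_log_norm_orbit_div (hd : 0 < d) {a σ : ℝ} (ha : 0 < a) (ha1 : a ≤ 1)
    (hσ : 0 < σ) {x0 : EuclideanSpace ℝ (Fin d)} (hx0 : x0 ≠ 0) :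
    ∀ᵐ h ∂(weightLaw d σ), Tendsto (fun k : ℕ => Real.log ‖orbit a x0 k h‖ / k) atTop
      (𝓝 (lyapunov a σ d)) := by
  have hmg := measurable_growth (d := d) a σ
  have hmf := measurable_factor (d := d) a x0
  have hident : ∀ k, IdentDistrib (fun h => Real.log (factor a x0 k h))
      (fun z => Real.log (growth a σ z)) (weightLaw d σ) (stdGaussian _) := fun k =>
    (IdentDistrib.mk (hmf k).aemeasurable hmg.aemeasurable (map_factor a σ hx0 k)).comp
      Real.measurable_log
  have hslln := strong_law_ae_real (μ := weightLaw d σ) (fun k h => Real.log (factor a x0 k h))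
    ((hident 0).integrable_iff.2 (integrable_log_growth hd ha ha1 hσ))
    (fun i j hij => (pairwise_indepFun_factor a σ hx0 hij).comp
      Real.measurable_log Real.measurable_log)
    (fun k => (hident k).trans (hident 0).symm)
  filter_upwards [hslln, ae_factor_pos hd ha ha1 hσ hx0] with h hlim hpos
  rw [(hident 0).integral_eq] at hlim
  have h0 : Tendsto (fun k : ℕ => Real.log ‖x0‖ / (k : ℝ)) atTop (𝓝 0) :=
    tendsto_const_div_atTop_nhds_zero_nat _
  have h1 := h0.add hlim
  rw [zero_add] at h1
  refine h1.congr fun k => ?_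
  rw [log_norm_orbit hx0 hpos, add_div]

/-- The current norm and the next factor are independent, so each layer multiplies the moment by the
same constant. -/
lemma lintegral_enorm_orbit_rpow (a σ : ℝ) {x0 : EuclideanSpace ℝ (Fin d)} (hx0 : x0 ≠ 0)
    {p : ℝ} (hp : 0 < p) (k : ℕ) :
    ∫⁻ h, ‖orbit a x0 k h‖ₑ ^ p ∂(weightLaw d σ) = ‖x0‖ₑ ^ p *
      (∫⁻ z, ‖growth a σ z‖ₑ ^ p ∂(stdGaussian (EuclideanSpace ℝ (Fin d)))) ^ k := by
  have hpow : Measurable fun r : ℝ => ‖r‖ₑ ^ p := by fun_prop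
  have hpow' : Measurable fun x : EuclideanSpace ℝ (Fin d) => ‖x‖ₑ ^ p := by fun_prop
  induction k with
  | zero => simp [orbit]
  | succ k ih =>
    have h1 : ∀ h, ‖orbit a x0 (k + 1) h‖ₑ ^ p
        = ‖orbit a x0 k h‖ₑ ^ p * ‖factor a x0 k h‖ₑ ^ p := by
      intro h
      rw [← enorm_norm, norm_orbit_succ, enorm_mul, enorm_norm, ENNReal.mul_rpow_of_nonneg _ _ hp.le]
    have h2 : ∫⁻ h, ‖factor a x0 k h‖ₑ ^ p ∂(weightLaw d σ)
        = ∫⁻ z, ‖growth a σ z‖ₑ ^ p ∂(stdGaussian (EuclideanSpace ℝ (Fin d))) := by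
      rw [← lintegral_map hpow (measurable_factor a x0 k), map_factor a σ hx0,
        lintegral_map hpow (measurable_growth a σ)]
    have h3 := lintegral_mul_eq_lintegral_mul_lintegral_of_indepFun
      (hpow'.comp (measurable_orbit a x0 k)) (hpow.comp (measurable_factor a x0 k))
      ((indepFun_orbit_factor a σ hx0 k).comp hpow' hpow)
    simp only [Pi.mul_apply, Function.comp_apply] at h3
    simp only [h1]
    rw [h3, h2, ih, pow_succ, mul_assoc]

lemma eLpNorm_orbit (hd : 0 < d) {a σ : ℝ} (ha : 0 < a) (ha1 : a ≤ 1) (hσ : 0 < σ)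
    {x0 : EuclideanSpace ℝ (Fin d)} (hx0 : x0 ≠ 0) {p : ℝ} (hp : 0 < p) (k : ℕ) :
    eLpNorm (orbit a x0 k) (ENNReal.ofReal p) (weightLaw d σ)
      = (‖x0‖ₑ ^ p * ENNReal.ofReal (mgf (fun z => Real.log (growth a σ z))
        (stdGaussian (EuclideanSpace ℝ (Fin d))) p) ^ k) ^ (1 / p) := by
  rw [eLpNorm_eq_lintegral_rpow_enorm_toReal (by simpa using hp) ENNReal.ofReal_ne_top,
    ENNReal.toReal_ofReal hp.le, lintegral_enorm_orbit_rpow a σ hx0 hp,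
    lintegral_enorm_growth_rpow hd ha ha1 hσ hp]

lemma memLp_orbit (hd : 0 < d) {a σ : ℝ} (ha : 0 < a) (ha1 : a ≤ 1) (hσ : 0 < σ)
    {x0 : EuclideanSpace ℝ (Fin d)} (hx0 : x0 ≠ 0) {p : ℝ} (hp : 0 < p) (k : ℕ) :
    MemLp (orbit a x0 k) (ENNReal.ofReal p) (weightLaw d σ) := by
  refine ⟨(measurable_orbit a x0 k).aestronglyMeasurable, ?_⟩
  rw [eLpNorm_orbit hd ha ha1 hσ hx0 hp]
  refine ENNReal.rpow_lt_top_of_nonneg (by positivity) (ENNReal.mul_ne_top ?_ ?_)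
  · exact ENNReal.rpow_ne_top_of_nonneg hp.le enorm_ne_top
  · exact ENNReal.pow_ne_top ENNReal.ofReal_ne_top

lemma tendsto_eLpNorm_orbit_zero (hd : 0 < d) {a σ : ℝ} (ha : 0 < a) (ha1 : a ≤ 1) (hσ : 0 < σ)
    {x0 : EuclideanSpace ℝ (Fin d)} (hx0 : x0 ≠ 0) {p : ℝ} (hp : 0 < p)
    (h : mgf (fun z => Real.log (growth a σ z)) (stdGaussian (EuclideanSpace ℝ (Fin d))) p < 1) :
    Tendsto (fun k => eLpNorm (orbit a x0 k) (ENNReal.ofReal p) (weightLaw d σ)) atTop (𝓝 0) := by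
  simp only [eLpNorm_orbit hd ha ha1 hσ hx0 hp]
  have h1 := ENNReal.tendsto_pow_atTop_nhds_zero_of_lt_one (ENNReal.ofReal_lt_one.2 h)
  have h2 := ENNReal.Tendsto.const_mul (a := ‖x0‖ₑ ^ p) h1
    (Or.inr (ENNReal.rpow_ne_top_of_nonneg hp.le enorm_ne_top))
  rw [mul_zero] at h2
  have h3 := ((ENNReal.continuous_rpow_const (y := 1 / p)).tendsto 0).comp h2
  rwa [ENNReal.zero_rpow_of_pos (by positivity)] at h3

lemma tendsto_eLpNorm_orbit_top (hd : 0 < d) {a σ : ℝ} (ha : 0 < a) (ha1 : a ≤ 1) (hσ : 0 < σ)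
    {x0 : EuclideanSpace ℝ (Fin d)} (hx0 : x0 ≠ 0) {p : ℝ} (hp : 0 < p)
    (h : 1 < mgf (fun z => Real.log (growth a σ z)) (stdGaussian (EuclideanSpace ℝ (Fin d))) p) :
    Tendsto (fun k => eLpNorm (orbit a x0 k) (ENNReal.ofReal p) (weightLaw d σ)) atTop (𝓝 ⊤) := by
  simp only [eLpNorm_orbit hd ha ha1 hσ hx0 hp]
  have h1 := ENNReal.tendsto_pow_atTop_nhds_top_iff.2 (ENNReal.one_lt_ofReal.2 h)
  have h0 : ‖x0‖ₑ ^ p ≠ 0 := by simp [ENNReal.rpow_eq_zero_iff, hx0, hp.not_gt]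
  have h2 := ENNReal.Tendsto.const_mul (a := ‖x0‖ₑ ^ p) h1 (Or.inl ENNReal.top_ne_zero)
  rw [ENNReal.mul_top h0] at h2
  have h3 := ((ENNReal.continuous_rpow_const (y := 1 / p)).tendsto ⊤).comp h2
  rwa [ENNReal.top_rpow_of_pos (by positivity)] at h3

lemma measure_orbit_zero_ne_zero (σ : ℝ) {x0 : EuclideanSpace ℝ (Fin d)} (hx0 : x0 ≠ 0) (k : ℕ) :
    weightLaw d σ {h | orbit 0 x0 k h ≠ 0}
      = (stdGaussian (EuclideanSpace ℝ (Fin d)) {z | growth 0 σ z ≠ 0}) ^ k := by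
  induction k with
  | zero => simp [orbit, hx0]
  | succ k ih =>
    have h1 : {h : ℕ × Fin d × Fin d → ℝ | orbit 0 x0 (k + 1) h ≠ 0}
        = orbit 0 x0 k ⁻¹' {0}ᶜ ∩ factor 0 x0 k ⁻¹' {0}ᶜ := by
      ext h
      rw [Set.mem_ofPred_eq, ← norm_ne_zero_iff, norm_orbit_succ, mul_ne_zero_iff, norm_ne_zero_iff]
      rfl
    have h2 : weightLaw d σ (factor 0 x0 k ⁻¹' {0}ᶜ)
        = stdGaussian (EuclideanSpace ℝ (Fin d)) {z | growth 0 σ z ≠ 0} := by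
      have hs : MeasurableSet ({0}ᶜ : Set ℝ) := (measurableSet_singleton 0).compl
      rw [← Measure.map_apply (measurable_factor 0 x0 k) hs, map_factor 0 σ hx0,
        Measure.map_apply (measurable_growth 0 σ) hs]
      rfl
    rw [h1, (indepFun_orbit_factor 0 σ hx0 k).measure_inter_preimage_eq_mul _ _
      (measurableSet_singleton 0).compl (measurableSet_singleton 0).compl, h2, pow_succ, ← ih]
    rfl

/-- For the ReLU activation the outputs vanish from some layer on. -/
lemma ae_tendsto_orbit_relu {σ : ℝ} (hσ : 0 < σ) {x0 : EuclideanSpace ℝ (Fin d)} (hx0 : x0 ≠ 0) :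
    ∀ᵐ h ∂(weightLaw d σ), Tendsto (fun k => orbit 0 x0 k h) atTop (𝓝 0) := by
  have hq : stdGaussian (EuclideanSpace ℝ (Fin d)) {z | growth 0 σ z ≠ 0} < 1 := by
    have hm : MeasurableSet {z : EuclideanSpace ℝ (Fin d) | growth 0 σ z = 0} :=
      measurable_growth 0 σ (measurableSet_singleton 0)
    have h1 : {z : EuclideanSpace ℝ (Fin d) | growth 0 σ z ≠ 0} = {z | growth 0 σ z = 0}ᶜ := rfl
    rw [h1, prob_compl_eq_one_sub hm]
    exact ENNReal.sub_lt_self ENNReal.one_ne_top one_ne_zero (measure_growth_zero_pos hσ).ne'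
  have hex : ∀ᵐ h ∂(weightLaw d σ), ∃ k, orbit 0 x0 k h = 0 := by
    rw [ae_iff]
    -- Never vanishing has probability at most `qᵏ` for every `k`, where `q < 1` is the probability
    -- that a factor is nonzero.
    refine le_antisymm (ge_of_tendsto' (ENNReal.tendsto_pow_atTop_nhds_zero_of_lt_one hq)
      fun k => ?_) bot_le
    rw [← measure_orbit_zero_ne_zero σ hx0 k]
    exact measure_mono fun h hh hk => hh ⟨k, hk⟩
  filter_upwards [hex] with h ⟨k, hk⟩
  refine tendsto_const_nhds.congr' ?_
  filter_upwards [eventually_ge_atTop k] with j hj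
  induction j, hj using Nat.le_induction with
  | base => exact hk.symm
  | succ j _ ih =>
    rw [eq_comm, ← norm_eq_zero, norm_orbit_succ, ← ih, norm_zero, zero_mul]

end ReLUNet

/-! ### Transfer to the given probability space. -/

theorem mainTheorem5 {Ω : Type*} [MeasurableSpace Ω] (P : Measure Ω) [IsProbabilityMeasure P]
    {d : ℕ} (a σ : ℝ) (ha : a ∈ Set.Icc (0 : ℝ) 1)
    (W : ℕ → Ω → Matrix (Fin d) (Fin d) ℝ) (b : ℕ → EuclideanSpace ℝ (Fin d))
    (hW : ReLUNet.IsGaussianInit P σ W b)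
    (x0 : EuclideanSpace ℝ (Fin d)) (hx0 : x0 ≠ 0) :
    -- ReLU
    (a = 0 → ∀ᵐ ω ∂P, Tendsto (fun k => ReLUNet.output a W b x0 k ω) atTop (𝓝 0)) ∧
    -- parametric ReLU and linear activation
    (0 < a →
      -- `μ_a(σ)` is the exponential growth rate of the layer outputs
      (∀ᵐ ω ∂P, Tendsto (fun k : ℕ => Real.log ‖ReLUNet.output a W b x0 k ω‖ / k) atTop
        (𝓝 (ReLUNet.lyapunov a σ d))) ∧
      (ReLUNet.lyapunov a σ d < 0 ↔ ∃ s : ℝ, 0 < s ∧ σ = ReLUNet.critSigma a s d) ∧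
      (∀ s : ℝ, 0 < s → σ = ReLUNet.critSigma a s d →
        (1 ≤ s → ∀ᵐ ω ∂P, Tendsto (fun k => ReLUNet.output a W b x0 k ω) atTop (𝓝 0)) ∧
        (∀ p : ℝ, 0 < p → p < s →
          (∀ k, MemLp (ReLUNet.output a W b x0 k) (ENNReal.ofReal p) P) ∧
          Tendsto (fun k => eLpNorm (ReLUNet.output a W b x0 k) (ENNReal.ofReal p) P) atTop
            (𝓝 0)) ∧
        (∃ n : ℕ → ℕ, StrictMono n ∧
          ∀ᵐ ω ∂P, Tendsto (fun k => ReLUNet.output a W b x0 (n k) ω) atTop (𝓝 0))) ∧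
      (0 < ReLUNet.lyapunov a σ d →
        (∀ p : ℝ, 0 < p →
          (∀ k, MemLp (ReLUNet.output a W b x0 k) (ENNReal.ofReal p) P) ∧
          Tendsto (fun k => eLpNorm (ReLUNet.output a W b x0 k) (ENNReal.ofReal p) P) atTop
            (𝓝 ⊤)) ∧
        (∃ n : ℕ → ℕ, StrictMono n ∧
          ∀ᵐ ω ∂P, Tendsto (fun k => ‖ReLUNet.output a W b x0 (n k) ω‖) atTop atTop))) := by

  have hd : 0 < d := by
    rcases Nat.eq_zero_or_pos d with rfl | h
    · exact absurd (Subsingleton.elim x0 0) hx0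
    · exact h
  have hσ := hW.sigma_pos
  obtain ⟨ha0, ha1⟩ := ha
  set T : Ω → ℕ × Fin d × Fin d → ℝ := fun ω q => W q.1 ω q.2.1 q.2.2 with hT
  have hmeas : ∀ q : ℕ × Fin d × Fin d, AEMeasurable (fun ω => W q.1 ω q.2.1 q.2.2) P :=
    fun q => (hW.gaussian q.1 q.2.1 q.2.2).aemeasurable
  have hTm : AEMeasurable T P := aemeasurable_pi_iff.2 hmeas
  -- All outputs are functions of the weight family `T`, so its law alone decides every claim, and
  -- the canonical product space suffices.
  have hlaw : P.map T = ReLUNet.weightLaw d σ := by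
    refine ((iIndepFun_iff_map_fun_eq_infinitePi_map₀' hmeas).1 hW.indep).trans ?_
    rw [ReLUNet.weightLaw]
    congr 1; funext q
    exact (hW.gaussian q.1 q.2.1 q.2.2).map_eq
  have hout : ∀ k, ReLUNet.output a W b x0 k = ReLUNet.orbit a x0 k ∘ T := fun k =>
    funext fun ω => ReLUNet.output_eq_orbit a W hW.bias_zero x0 k ω
  have hae : ∀ {p : (ℕ × Fin d × Fin d → ℝ) → Prop}, (∀ᵐ h ∂(ReLUNet.weightLaw d σ), p h) →
      ∀ᵐ ω ∂P, p (T ω) := fun h => ae_of_ae_map hTm (by rwa [hlaw])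
  have hsm : ∀ k, AEStronglyMeasurable (ReLUNet.orbit a x0 k) (P.map T) := fun k =>
    (ReLUNet.measurable_orbit a x0 k).aestronglyMeasurable
  have heLp : ∀ (p : ENNReal) k, eLpNorm (ReLUNet.orbit a x0 k ∘ T) p P
      = eLpNorm (ReLUNet.orbit a x0 k) p (ReLUNet.weightLaw d σ) := fun p k => by
    rw [← hlaw, eLpNorm_map_measure (hsm k) hTm]
  simp only [hout, heLp, Function.comp_apply]
  refine ⟨?_, fun ha => ?_⟩
  · rintro rfl
    exact hae (ReLUNet.ae_tendsto_orbit_relu hσ hx0)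
  have hrate := ReLUNet.ae_tendsto_log_norm_orbit_div hd ha ha1 hσ hx0
  have hpos := ReLUNet.ae_factor_pos hd ha ha1 hσ hx0
  have hmem : ∀ p : ℝ, 0 < p → ∀ k, MemLp (ReLUNet.orbit a x0 k ∘ T) (ENNReal.ofReal p) P :=
    fun p hp k => (memLp_map_measure_iff (hsm k) hTm).1
      (by rw [hlaw]; exact ReLUNet.memLp_orbit hd ha ha1 hσ hx0 hp k)
  have hint : ∀ {s : ℝ}, 0 < s → Integrable (fun z => Real.exp (s * Real.log
      (ReLUNet.growth a σ z))) (stdGaussian (EuclideanSpace ℝ (Fin d))) := fun hs =>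
    ReLUNet.integrable_exp_mul_log_growth_of_nonneg hd ha ha1 hσ hs.le
  refine ⟨hae hrate, ReLUNet.lyapunov_neg_iff hd ha ha1 hσ, fun s hs hcrit => ?_, fun hμ => ?_⟩
  · have hμ := (ReLUNet.lyapunov_neg_iff hd ha ha1 hσ).2 ⟨s, hs, hcrit⟩
    have hzero : ∀ᵐ ω ∂P, Tendsto (fun k => ReLUNet.orbit a x0 k (T ω)) atTop (𝓝 0) := by
      refine hae (p := fun h => Tendsto (fun k => ReLUNet.orbit a x0 k h) atTop (𝓝 0)) ?_
      filter_upwards [hrate, hpos] with h h1 h2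
      exact tendsto_zero_iff_norm_tendsto_zero.2 (ReLUNet.tendsto_zero_of_tendsto_log_div
        (ReLUNet.norm_orbit_pos hx0 h2) h1 hμ)
    -- A negative exponent gives almost sure convergence of the full sequence for every `s > 0`, so
    -- the identity serves as the index sequence.
    refine ⟨fun _ => hzero, fun p hp hps => ⟨hmem p hp, ?_⟩, id, strictMono_id, hzero⟩
    exact ReLUNet.tendsto_eLpNorm_orbit_zero hd ha ha1 hσ hx0 hp
      (ReLUNet.mgf_lt_one_of_lt hp hps (hint hp) (hint hs)
        (ReLUNet.measure_log_growth_ne_zero_pos hd hσ)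
        ((ReLUNet.eq_critSigma_iff hd ha ha1 hσ hs).1 hcrit))
  · refine ⟨fun p hp => ⟨hmem p hp, ?_⟩, id, strictMono_id, ?_⟩
    · exact ReLUNet.tendsto_eLpNorm_orbit_top hd ha ha1 hσ hx0 hp
        (ReLUNet.one_lt_mgf_of_integral_pos (ReLUNet.integrable_log_growth hd ha ha1 hσ) hp
          (hint hp) hμ)
    · refine hae (p := fun h => Tendsto (fun k => ‖ReLUNet.orbit a x0 (id k) h‖) atTop atTop) ?_
      filter_upwards [hrate, hpos] with h h1 h2
      exact ReLUNet.tendsto_atTop_of_tendsto_log_div (ReLUNet.norm_orbit_pos hx0 h2) h1 hμ
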